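/- Let $n\ge 1$, $J>0$, $\phi\in\mathbb R$. For a ring of $N\ge n+2$ spins $1/2$ (sites $0,\dots,N-1$, indices read modulo $N$) let $$H_N=J\Big(\sin\phi\sum_{j}\sigma^y_j\sigma^y_{j+1}-\cos\phi\sum_j\sigma^x_j\,\sigma^z_{j+1}\cdots\sigma^z_{j+n}\,\sigma^x_{j+n+1}\Big)$$ be the Hamiltonian of the $n$-cluster-Ising model. Let $\langle X\rangle_N=\operatorname{tr}(P_NX)/\operatorname{tr}P_N$, where $P_N$ is the orthogonal projection onto the eigenspace of $H_N$ for its lowest eigenvalue (so $\langle X\rangle_N=\langle\psi,X\psi\rangle$ if the normalized ground state $\psi$ is unique; in case of degeneracy this is the zero-temperature limit of the Gibbs state). Put $c_j=\big(\prod_{k<j}\sigma^z_k\big)\sigma^-_j$ and $c_j^\dagger=\big(\prod_{k<j}\sigma^z_k\big)\sigma^+_j$ with $\sigma^\pm=(\sigma^x\pm i\sigma^y)/2$, and $A_j=c_j+c_j^\dagger$, $B_j=c_j-c_j^\dagger$. For $r\in\mathbb Z$ let $$G_r(n,\phi)=\frac1\pi\int_0^\pi\frac{\cos(k(n+1+r))\cos\phi-\cos(k(r-1))\sin\phi}{\sqrt{1-\cos((n+2)k)\sin(2\phi)}}\,dk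 .$$ Then the following hold. 1. For all sites $i,k\ge 0$, $\lim_{N\to\infty}\langle B_iA_k\rangle_N=G_{i-k}(n,\phi)$. 2. $G_r(n,\phi)=0$ unless $r=l(n+2)+1$ for some integer $l$. 3. For every site $i$, $\lim_{N\to\infty}\langle\sigma^z_i\rangle_N=0$. 4. For all sites $i\ne k$, $\lim_{N\to\infty}\langle\sigma^z_i\sigma^z_k\rangle_N=0$. 5. For every $N\ge n+2$, if $W$ is a product of Pauli operators $\sigma^x,\sigma^y,\sigma^z$ acting on pairwise different sites of the ring in which the number of factors $\sigma^x$ is odd or the number of factors $\sigma^y$ is odd, then $\langle W\rangle_N=0$. -/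

import Mathlib

open Filter Topology
open scoped BigOperators

namespace ClusterIsing

/-- Operators on the Hilbert space `(ℂ²)^{⊗ N}` of a ring of `N` spins 1/2, as matrices in the
product basis of the configurations `Fin N → Fin 2` (`0` is spin up, `1` is spin down). -/
abbrev Op (N : ℕ) : Type := Matrix (Fin N → Fin 2) (Fin N → Fin 2) ℂ

/-- The Pauli matrix `σ^x`. -/
def σx : Matrix (Fin 2) (Fin 2) ℂ := !![0, 1; 1, 0]

/-- The Pauli matrix `σ^y`. -/
def σy : Matrix (Fin 2) (Fin 2) ℂ := !![0, -Complex.I; Complex.I, 0]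

/-- The Pauli matrix `σ^z`. -/
def σz : Matrix (Fin 2) (Fin 2) ℂ := !![1, 0; 0, -1]

/-- The raising operator `σ^+ = (σ^x + i σ^y) / 2`. -/
noncomputable def σplus : Matrix (Fin 2) (Fin 2) ℂ := (1 / 2 : ℂ) • (σx + Complex.I • σy)

/-- The lowering operator `σ^- = (σ^x - i σ^y) / 2`. -/
noncomputable def σminus : Matrix (Fin 2) (Fin 2) ℂ := (1 / 2 : ℂ) • (σx - Complex.I • σy)

/-- The tensor product `M_0 ⊗ M_1 ⊗ ⋯ ⊗ M_{N-1}` of one-spin operators. -/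
def tensorOp {N : ℕ} (M : Fin N → Matrix (Fin 2) (Fin 2) ℂ) : Op N :=
  Matrix.of fun s t => ∏ l : Fin N, M l (s l) (t l)

/-- The one-spin operator `m` acting on the site `j` (read modulo `N`) of the ring of `N` sites
`0, …, N - 1`, and the identity on all other sites. -/
def siteOp (N : ℕ) (m : Matrix (Fin 2) (Fin 2) ℂ) (j : ℕ) : Op N :=
  tensorOp fun l : Fin N => if (l : ℕ) = j % N then m else 1

/-- The operator `O^z_{j,n} = σ^z_{j+1} σ^z_{j+2} ⋯ σ^z_{j+n}`. -/
def clusterZ (N n j : ℕ) : Op N :=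
  ((List.range n).map fun k => siteOp N σz (j + k + 1)).prod

/-- The Hamiltonian of the `n`-cluster-Ising model on the ring of `N` spins,
`J (sin φ ∑_j σ^y_j σ^y_{j+1} - cos φ ∑_j σ^x_j O^z_{j,n} σ^x_{j+n+1})`,
with all sites read modulo `N`. -/
noncomputable def hamiltonian (N n : ℕ) (J φ : ℝ) : Op N :=
  (J : ℂ) •
    ((Real.sin φ : ℂ) • ∑ j ∈ Finset.range N, siteOp N σy j * siteOp N σy (j + 1)
      - (Real.cos φ : ℂ) • ∑ j ∈ Finset.range N,
          siteOp N σx j * clusterZ N n j * siteOp N σx (j + n + 1))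

/-- The Jordan–Wigner string `∏_{k < j} σ^z_k`. -/
def jwString (N j : ℕ) : Op N :=
  ((List.range j).map fun k => siteOp N σz k).prod

/-- The fermionic annihilation operator `c_j = (∏_{k < j} σ^z_k) σ^-_j`, for `j < N`. -/
noncomputable def fermi (N j : ℕ) : Op N := jwString N j * siteOp N σminus j

/-- The fermionic creation operator `c_j† = (∏_{k < j} σ^z_k) σ^+_j`, for `j < N`. -/
noncomputable def fermiDag (N j : ℕ) : Op N := jwString N j * siteOp N σplus j

/-- `A_j = c_j + c_j†`. -/
noncomputable def opA (N j : ℕ) : Op N := fermi N j + fermiDag N j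

/-- `B_j = c_j - c_j†`. -/
noncomputable def opB (N j : ℕ) : Op N := fermi N j - fermiDag N j

/-- An operator as a linear endomorphism of the Hilbert space. -/
noncomputable def toEnd {N : ℕ} (X : Op N) :
    EuclideanSpace ℂ (Fin N → Fin 2) →ₗ[ℂ] EuclideanSpace ℂ (Fin N → Fin 2) :=
  Matrix.toEuclideanLin X

/-- The ground-state energy: the lowest (real) eigenvalue of the Hamiltonian. -/
noncomputable def groundEnergy (N n : ℕ) (J φ : ℝ) : ℝ :=
  sInf {E : ℝ | Module.End.HasEigenvalue (toEnd (hamiltonian N n J φ)) (E : ℂ)}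

/-- The space of ground states: the eigenspace of the Hamiltonian at its lowest eigenvalue. -/
noncomputable def groundSpace (N n : ℕ) (J φ : ℝ) :
    Submodule ℂ (EuclideanSpace ℂ (Fin N → Fin 2)) :=
  Module.End.eigenspace (toEnd (hamiltonian N n J φ)) (groundEnergy N n J φ : ℂ)

/-- The ground-state expectation `⟨X⟩ = tr (P X) / tr P` on the ring of `N` spins, where `P` is the
orthogonal projection onto the space of ground states.  If the ground state `ψ` is unique (and
normalized) this is `⟨ψ, X ψ⟩`; in case of degeneracy it is the zero-temperature limit of the
Gibbs state, which has all the symmetries of the Hamiltonian. -/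
noncomputable def expect (N n : ℕ) (J φ : ℝ) (X : Op N) : ℂ :=
  LinearMap.trace ℂ (EuclideanSpace ℂ (Fin N → Fin 2))
      (((groundSpace N n J φ).starProjection :
          EuclideanSpace ℂ (Fin N → Fin 2) →ₗ[ℂ] EuclideanSpace ℂ (Fin N → Fin 2)) ∘ₗ toEnd X)
    / (Module.finrank ℂ (groundSpace N n J φ) : ℂ)

/-- The integral expression of the two-point function
`G_r(n, φ) = (1/π) ∫_0^π (cos (k (n+1+r)) cos φ - cos (k (r-1)) sin φ)
  / √(1 - cos ((n+2) k) sin (2 φ)) dk`. -/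
noncomputable def G (n : ℕ) (φ : ℝ) (r : ℤ) : ℝ :=
  (1 / Real.pi) * ∫ k in (0 : ℝ)..Real.pi,
    (Real.cos (k * ((n : ℝ) + 1 + (r : ℝ))) * Real.cos φ
        - Real.cos (k * ((r : ℝ) - 1)) * Real.sin φ)
      / Real.sqrt (1 - Real.cos (((n : ℝ) + 2) * k) * Real.sin (2 * φ))

/-- The one-spin operators `1, σ^x, σ^y, σ^z`, labelled by `0, 1, 2, 3`. -/
def pauli : Fin 4 → Matrix (Fin 2) (Fin 2) ℂ := ![1, σx, σy, σz]

end ClusterIsing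

/-! The Jordan–Wigner map turns every coupling that does not wrap around the ring into a fermion
bilinear: the Ising bond is $B_{j+1}A_j$ and the cluster bond is $B_jA_{j+n+1}$. The wrapping
couplings are not treated as bilinears, and the ground state need not be unique. The proof therefore
avoids diagonalization and Wick's theorem. It is variational, and the finitely many wrapping
couplings cost only $O(1)$ in energy.

Let $s(k)=\cos\phi\,e^{i(n+1)k}-\sin\phi\,e^{-ik}$ (`symbol`), and for the ground state put
$f_N(k)=\frac1N\sum_{i,j}e^{i(i-j)k}\langle B_iA_j\rangle$ (`fejer`). Up to $O(1)$ the energy is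
$-JN\frac1{2\pi}\int\mathrm{Re}(f_Ns)$. The matrix of $H$ is real symmetric, so $\langle
A_iA_j\rangle=\langle B_iB_j\rangle=0$ for $i\ne j$, and Cauchy–Schwarz gives $|f_N|\le1$
(`norm_fejer_corrBA_le`). Conversely, any real orthogonal matrix is the $BA$-correlation matrix of
some vector. A circulant one gives a trial energy $-J\sum|s|$ over the discrete momenta, up to
$O(1)$ (`groundEnergy_le_sum`). Hence $\int(|s|-\mathrm{Re}(f_Ns))\to0$. Since $s\ne0$ almost
everywhere, this forces $f_N\to\bar s/|s|$ in $L^1$. The Fourier coefficients of the limit are the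
$G_r$, and translation invariance turns convergence of diagonal averages into convergence of each
correlation.

The support of $G_r$ comes from a symmetry: both exponents of $s$ agree modulo $n+2$, so a shift of
$k$ by $2\pi/(n+2)$ only multiplies $s$ by a phase.

For $\sigma^z_i\sigma^z_k=A_iB_iA_kB_k$, let $E=A_i+\sum_jc_jB_j$ with $c_j=G_{j-i}$ truncated to a
finite window. Then $\langle E^\dagger E\rangle\to1-\sum_j c_j^2$, which is small by Parseval
because the limit symbol has modulus one. Moving the almost annihilating $E$ through the other three
operators leaves only contractions with the factors $G_0=0$ and $G_{k-i}G_{i-k}=0$; the second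
vanishing needs $n\ge1$.

The selection rule for Pauli strings follows from two exact symmetries of the ground projection:
transposition and conjugation by $\prod_l\sigma^z_l$. -/

namespace ClusterIsing

open Matrix

/-! ### Algebra of tensor products of one-spin operators -/

section TensorProducts

variable {N : ℕ}

theorem tensorOp_mul (M M' : Fin N → Matrix (Fin 2) (Fin 2) ℂ) :
    tensorOp M * tensorOp M' = tensorOp fun l => M l * M' l := by
  ext s t
  simp only [tensorOp, Matrix.mul_apply, Matrix.of_apply, ← Finset.prod_mul_distrib]
  rw [Fintype.prod_sum]

theorem tensorOp_one : tensorOp (fun _ : Fin N => 1) = 1 := by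
  ext s t
  simp only [tensorOp, Matrix.of_apply, Matrix.one_apply, Finset.prod_ite_zero, Finset.prod_const_one,
    funext_iff, Finset.mem_univ, true_implies]

theorem tensorOp_conjTranspose (M : Fin N → Matrix (Fin 2) (Fin 2) ℂ) :
    (tensorOp M)ᴴ = tensorOp fun l => (M l)ᴴ := by
  ext s t
  simp [tensorOp, Matrix.conjTranspose_apply]

theorem tensorOp_transpose (M : Fin N → Matrix (Fin 2) (Fin 2) ℂ) :
    (tensorOp M)ᵀ = tensorOp fun l => (M l)ᵀ := by
  ext s t
  simp [tensorOp]

theorem tensorOp_map_star (M : Fin N → Matrix (Fin 2) (Fin 2) ℂ) :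
    (starRingEnd ℂ).mapMatrix (tensorOp M) = tensorOp fun l => (starRingEnd ℂ).mapMatrix (M l) := by
  ext s t
  simp [tensorOp]

theorem tensorOp_smul (c : Fin N → ℂ) (M : Fin N → Matrix (Fin 2) (Fin 2) ℂ) :
    tensorOp (fun l => c l • M l) = (∏ l, c l) • tensorOp M := by
  ext s t
  simp [tensorOp, Finset.prod_mul_distrib]

/-- Homogeneity in a single factor; the phases and signs of the Jordan–Wigner calculus are extracted
through this lemma. -/
theorem tensorOp_eq_smul {M M' : Fin N → Matrix (Fin 2) (Fin 2) ℂ} (c : ℂ) (l₀ : Fin N)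
    (h₀ : M l₀ = c • M' l₀) (h : ∀ l, l ≠ l₀ → M l = M' l) : tensorOp M = c • tensorOp M' := by
  have : M = fun l => (if l = l₀ then c else 1) • M' l := by
    funext l
    by_cases hl : l = l₀
    · subst hl; simp [h₀]
    · simp [hl, h l hl]
  rw [this, tensorOp_smul]
  simp

theorem tensorOp_anticomm {M M' : Fin N → Matrix (Fin 2) (Fin 2) ℂ} (l₀ : Fin N)
    (h₀ : M l₀ * M' l₀ = -(M' l₀ * M l₀)) (h : ∀ l, l ≠ l₀ → M l * M' l = M' l * M l) :
    tensorOp M * tensorOp M' = -(tensorOp M' * tensorOp M) := by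
  rw [tensorOp_mul, tensorOp_mul, ← neg_one_smul ℂ]
  exact tensorOp_eq_smul _ l₀ (by rw [h₀, neg_one_smul]) h

theorem tensorOp_submatrix (τ : Equiv.Perm (Fin N)) (M : Fin N → Matrix (Fin 2) (Fin 2) ℂ) :
    (tensorOp M).submatrix (fun s l => s (τ l)) (fun s l => s (τ l)) =
      tensorOp fun l => M (τ.symm l) := by
  ext s t
  simp only [tensorOp, Matrix.submatrix_apply, Matrix.of_apply]
  exact Fintype.prod_equiv τ _ _ (fun l => by simp)

end TensorProducts

/-! ### Pauli matrix relations -/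

section Pauli

theorem σx_mul_self : σx * σx = 1 := by
  ext i j; fin_cases i <;> fin_cases j <;> simp [σx]
theorem σy_mul_self : σy * σy = 1 := by
  ext i j; fin_cases i <;> fin_cases j <;> simp [σy]
theorem σz_mul_self : σz * σz = 1 := by
  ext i j; fin_cases i <;> fin_cases j <;> simp [σz]
theorem σz_mul_σx : σz * σx = Complex.I • σy := by
  ext i j; fin_cases i <;> fin_cases j <;> simp [σx, σy, σz]
theorem σx_mul_σz : σx * σz = -(Complex.I • σy) := by
  ext i j; fin_cases i <;> fin_cases j <;> simp [σx, σy, σz]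
theorem σz_mul_σy : σz * σy = -(Complex.I • σx) := by
  ext i j; fin_cases i <;> fin_cases j <;> simp [σx, σy, σz]
theorem σy_mul_σz : σy * σz = Complex.I • σx := by
  ext i j; fin_cases i <;> fin_cases j <;> simp [σx, σy, σz]
theorem σx_mul_σy : σx * σy = Complex.I • σz := by
  ext i j; fin_cases i <;> fin_cases j <;> simp [σx, σy, σz]
theorem σy_mul_σx : σy * σx = -(Complex.I • σz) := by
  ext i j; fin_cases i <;> fin_cases j <;> simp [σx, σy, σz]
theorem σx_conjTranspose : σxᴴ = σx := by
  ext i j; fin_cases i <;> fin_cases j <;> simp [σx]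
theorem σy_conjTranspose : σyᴴ = σy := by
  ext i j; fin_cases i <;> fin_cases j <;> simp [σy]
theorem σz_conjTranspose : σzᴴ = σz := by
  ext i j; fin_cases i <;> fin_cases j <;> simp [σz]
theorem σx_transpose : σxᵀ = σx := by
  ext i j; fin_cases i <;> fin_cases j <;> simp [σx]
theorem σy_transpose : σyᵀ = -σy := by
  ext i j; fin_cases i <;> fin_cases j <;> simp [σy]
theorem σz_transpose : σzᵀ = σz := by
  ext i j; fin_cases i <;> fin_cases j <;> simp [σz]

theorem map_star_eq (m : Matrix (Fin 2) (Fin 2) ℂ) : (starRingEnd ℂ).mapMatrix m = mᴴᵀ := by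
  ext i j; simp

theorem sub_σminus_σplus : σminus - σplus = -(Complex.I • σy) := by
  simp only [σminus, σplus, ← smul_sub]
  ext i j; fin_cases i <;> fin_cases j <;> simp [σx, σy] <;> ring

theorem add_σminus_σplus : σminus + σplus = σx := by
  simp only [σminus, σplus, ← smul_add]
  ext i j; fin_cases i <;> fin_cases j <;> simp [σx, σy] <;> ring

end Pauli

/-! ### One-site operators and strings of σ^z -/

section SiteOperators

variable {N : ℕ}

theorem siteOp_mod (m : Matrix (Fin 2) (Fin 2) ℂ) (j : ℕ) :
    siteOp N m (j % N) = siteOp N m j := by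
  simp [siteOp]

theorem siteOp_add_card (m : Matrix (Fin 2) (Fin 2) ℂ) (j : ℕ) :
    siteOp N m (j + N) = siteOp N m j := by
  simp [siteOp]

theorem siteOp_mul (m m' : Matrix (Fin 2) (Fin 2) ℂ) (j : ℕ) :
    siteOp N m j * siteOp N m' j = siteOp N (m * m') j := by
  rw [siteOp, siteOp, siteOp, tensorOp_mul]
  congr 1; funext l; split_ifs <;> simp

theorem siteOp_one (j : ℕ) : siteOp N 1 j = 1 := by
  simp [siteOp, tensorOp_one]

theorem siteOp_commute {m m' : Matrix (Fin 2) (Fin 2) ℂ} {j k : ℕ} (h : j % N ≠ k % N) :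
    Commute (siteOp N m j) (siteOp N m' k) := by
  rw [Commute, SemiconjBy, siteOp, siteOp, tensorOp_mul, tensorOp_mul]
  congr 1; funext l
  by_cases h1 : (l : ℕ) = j % N
  · simp [h1, h]
  · simp [h1]

theorem siteOp_commute_self (m : Matrix (Fin 2) (Fin 2) ℂ) (j k : ℕ) :
    Commute (siteOp N m j) (siteOp N m k) := by
  by_cases h : j % N = k % N
  · rw [← siteOp_mod, h, siteOp_mod]
  · exact siteOp_commute h

theorem siteOp_conjTranspose (m : Matrix (Fin 2) (Fin 2) ℂ) (j : ℕ) :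
    (siteOp N m j)ᴴ = siteOp N mᴴ j := by
  rw [siteOp, siteOp, tensorOp_conjTranspose]
  congr 1; funext l; split_ifs <;> simp

theorem siteOp_map_star (m : Matrix (Fin 2) (Fin 2) ℂ) (j : ℕ) :
    (starRingEnd ℂ).mapMatrix (siteOp N m j) = siteOp N ((starRingEnd ℂ).mapMatrix m) j := by
  rw [siteOp, siteOp, tensorOp_map_star]
  congr 1; funext l; split_ifs
  · rfl
  · exact map_one _

theorem siteOp_smul [NeZero N] (c : ℂ) (m : Matrix (Fin 2) (Fin 2) ℂ) (j : ℕ) :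
    siteOp N (c • m) j = c • siteOp N m j := by
  refine tensorOp_eq_smul c ⟨j % N, Nat.mod_lt _ (NeZero.pos N)⟩ (by simp) ?_
  intro l hl
  have : ¬ (l : ℕ) = j % N := fun h => hl (Fin.ext h)
  simp [this]

theorem siteOp_neg [NeZero N] (m : Matrix (Fin 2) (Fin 2) ℂ) (j : ℕ) :
    siteOp N (-m) j = -siteOp N m j := by
  rw [← neg_one_smul ℂ m, siteOp_smul, neg_one_smul]

theorem clusterZ_succ (n j : ℕ) :
    clusterZ N (n + 1) j = clusterZ N n j * siteOp N σz (j + n + 1) := by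
  simp [clusterZ, List.range_succ]

theorem clusterZ_commute_siteOp {n j k : ℕ} {m : Matrix (Fin 2) (Fin 2) ℂ}
    (h : ∀ i < n, Commute (siteOp N σz (j + i + 1)) (siteOp N m k)) :
    Commute (clusterZ N n j) (siteOp N m k) := by
  induction n with
  | zero => simp [clusterZ]
  | succ n ih =>
    rw [clusterZ_succ]
    exact (ih fun i hi => h i (by omega)).mul_left (h n (by omega))

theorem clusterZ_conjTranspose (n j : ℕ) : (clusterZ N n j)ᴴ = clusterZ N n j := by
  induction n with
  | zero => simp [clusterZ]
  | succ n ih =>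
    rw [clusterZ_succ, Matrix.conjTranspose_mul, ih, siteOp_conjTranspose, σz_conjTranspose]
    exact (clusterZ_commute_siteOp fun i _ => siteOp_commute_self _ _ _).symm

theorem clusterZ_mul_self (n j : ℕ) : clusterZ N n j * clusterZ N n j = 1 := by
  induction n with
  | zero => simp [clusterZ]
  | succ n ih =>
    have h : Commute (clusterZ N n j) (siteOp N σz (j + n + 1)) :=
      clusterZ_commute_siteOp fun i _ => siteOp_commute_self _ _ _
    rw [clusterZ_succ, h.symm.mul_mul_mul_comm, ih, siteOp_mul, σz_mul_self, siteOp_one, one_mul]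

theorem clusterZ_map_star (n j : ℕ) :
    (starRingEnd ℂ).mapMatrix (clusterZ N n j) = clusterZ N n j := by
  induction n with
  | zero => simp only [clusterZ, List.range_zero, List.map_nil, List.prod_nil, map_one]
  | succ n ih =>
    rw [clusterZ_succ, map_mul, ih, siteOp_map_star, map_star_eq, σz_conjTranspose, σz_transpose]

end SiteOperators

/-! ### The couplings are real Hermitian involutions -/

section Couplings

variable {N : ℕ}

/-- The Ising coupling `σ^y_j σ^y_{j+1}`. -/
def isingTerm (N j : ℕ) : Op N := siteOp N σy j * siteOp N σy (j + 1)

/-- The cluster coupling `σ^x_j σ^z_{j+1} ⋯ σ^z_{j+n} σ^x_{j+n+1}`. -/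
def clusterTerm (N n j : ℕ) : Op N :=
  siteOp N σx j * clusterZ N n j * siteOp N σx (j + n + 1)

theorem hamiltonian_eq (n : ℕ) (J φ : ℝ) : hamiltonian N n J φ =
    (J : ℂ) • ((Real.sin φ : ℂ) • ∑ j ∈ Finset.range N, isingTerm N j
      - (Real.cos φ : ℂ) • ∑ j ∈ Finset.range N, clusterTerm N n j) := rfl

theorem isingTerm_conjTranspose (j : ℕ) : (isingTerm N j)ᴴ = isingTerm N j := by
  rw [isingTerm, Matrix.conjTranspose_mul, siteOp_conjTranspose, siteOp_conjTranspose,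
    σy_conjTranspose]
  exact siteOp_commute_self _ _ _

theorem isingTerm_mul_self (j : ℕ) : isingTerm N j * isingTerm N j = 1 := by
  rw [isingTerm, (siteOp_commute_self σy (j + 1) j).mul_mul_mul_comm, siteOp_mul, siteOp_mul,
    σy_mul_self, siteOp_one, siteOp_one, one_mul]

theorem isingTerm_map_star (j : ℕ) :
    (starRingEnd ℂ).mapMatrix (isingTerm N j) = isingTerm N j := by
  -- On the empty ring `siteOp` is the identity for every one-spin matrix, so scalars cannot be
  -- pulled out and this case is separate.
  rcases Nat.eq_zero_or_pos N with rfl | hN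
  · ext s t; simp [isingTerm, siteOp, tensorOp, Matrix.mul_apply]
  have : NeZero N := ⟨hN.ne'⟩
  rw [isingTerm, map_mul, siteOp_map_star, siteOp_map_star, map_star_eq, σy_conjTranspose,
    σy_transpose, siteOp_neg, siteOp_neg, neg_mul_neg]

/-- This is where `n + 2 ≤ N` acts: the $n+2$ consecutive sites of a cluster coupling are pairwise
distinct on the ring, so its factors commute. -/
theorem add_mod_ne {N a b : ℕ} (h1 : a < b) (h2 : b < a + N) : a % N ≠ b % N := by
  intro h
  have h3 : N ∣ b - a := (Nat.modEq_iff_dvd' h1.le).1 h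
  have := Nat.le_of_dvd (by omega) h3
  omega

theorem clusterZ_commute_left {n : ℕ} (hN : n + 2 ≤ N) (m : Matrix (Fin 2) (Fin 2) ℂ) (j : ℕ) :
    Commute (clusterZ N n j) (siteOp N m j) :=
  clusterZ_commute_siteOp fun i hi =>
    siteOp_commute (add_mod_ne (N := N) (a := j) (b := j + i + 1) (by omega) (by omega)).symm

theorem clusterZ_commute_right {n : ℕ} (hN : n + 2 ≤ N) (m : Matrix (Fin 2) (Fin 2) ℂ) (j : ℕ) :
    Commute (clusterZ N n j) (siteOp N m (j + n + 1)) :=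
  clusterZ_commute_siteOp fun i hi => siteOp_commute (add_mod_ne (by omega) (by omega))

theorem clusterTerm_conjTranspose {n : ℕ} (hN : n + 2 ≤ N) (j : ℕ) :
    (clusterTerm N n j)ᴴ = clusterTerm N n j := by
  rw [clusterTerm, Matrix.conjTranspose_mul, Matrix.conjTranspose_mul, siteOp_conjTranspose,
    siteOp_conjTranspose, clusterZ_conjTranspose, σx_conjTranspose,
    (clusterZ_commute_left hN σx j).eq]
  exact ((siteOp_commute_self σx (j + n + 1) j).mul_right (clusterZ_commute_right hN σx j).symm).eq

theorem clusterTerm_mul_self {n : ℕ} (hN : n + 2 ≤ N) (j : ℕ) :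
    clusterTerm N n j * clusterTerm N n j = 1 := by
  rw [clusterTerm, ((siteOp_commute_self σx (j + n + 1) j).mul_right
    (clusterZ_commute_right hN σx j).symm).mul_mul_mul_comm,
    (clusterZ_commute_left hN σx j).mul_mul_mul_comm, clusterZ_mul_self, siteOp_mul, siteOp_mul,
    σx_mul_self, siteOp_one, siteOp_one, one_mul, one_mul]

theorem clusterTerm_map_star (n j : ℕ) :
    (starRingEnd ℂ).mapMatrix (clusterTerm N n j) = clusterTerm N n j := by
  rw [clusterTerm, map_mul, map_mul, siteOp_map_star, siteOp_map_star, clusterZ_map_star,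
    map_star_eq, σx_conjTranspose, σx_transpose]

theorem hamiltonian_conjTranspose {n : ℕ} (hN : n + 2 ≤ N) (J φ : ℝ) :
    (hamiltonian N n J φ)ᴴ = hamiltonian N n J φ := by
  simp only [hamiltonian_eq, Matrix.conjTranspose_smul, Matrix.conjTranspose_sub,
    Matrix.conjTranspose_sum, isingTerm_conjTranspose, clusterTerm_conjTranspose hN,
    Complex.star_def, Complex.conj_ofReal]

theorem hamiltonian_map_star (n : ℕ) (J φ : ℝ) :
    (starRingEnd ℂ).mapMatrix (hamiltonian N n J φ) = hamiltonian N n J φ := by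
  have hs : ∀ (r : ℝ) (X : Op N), (starRingEnd ℂ).mapMatrix ((r : ℂ) • X) =
      (r : ℂ) • (starRingEnd ℂ).mapMatrix X := fun r X => by ext s t; simp
  simp only [hamiltonian_eq, hs, map_sub, map_sum, isingTerm_map_star, clusterTerm_map_star]

/-- A real Hermitian matrix is symmetric. This time-reversal symmetry later kills the $AA$ and $BB$
correlations and the Pauli strings with an odd number of σ^y. -/
theorem hamiltonian_transpose {n : ℕ} (hN : n + 2 ≤ N) (J φ : ℝ) :
    (hamiltonian N n J φ)ᵀ = hamiltonian N n J φ := by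
  conv_lhs => rw [← hamiltonian_conjTranspose hN]
  conv_rhs => rw [← hamiltonian_map_star]
  ext s t; simp

end Couplings

/-! ### Conservation of the parity ∏ σ^z -/

section Parity

variable {N : ℕ}

/-- The parity `∏_l σ^z_l`. -/
def parityOp (N : ℕ) : Op N := tensorOp fun _ => σz

theorem parityOp_mul_self : parityOp N * parityOp N = 1 := by
  rw [parityOp, tensorOp_mul]; simp [σz_mul_self, tensorOp_one]

theorem parityOp_anticomm_siteOp [NeZero N] {m : Matrix (Fin 2) (Fin 2) ℂ}
    (hm : σz * m = -(m * σz)) (j : ℕ) :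
    parityOp N * siteOp N m j = -(siteOp N m j * parityOp N) := by
  refine tensorOp_anticomm ⟨j % N, Nat.mod_lt _ (NeZero.pos N)⟩ (by simp [hm]) ?_
  intro l hl
  have : ¬ (l : ℕ) = j % N := fun h => hl (Fin.ext h)
  simp [this]

theorem parityOp_commute_siteOp_σz (j : ℕ) : Commute (parityOp N) (siteOp N σz j) := by
  rw [Commute, SemiconjBy, siteOp, parityOp, tensorOp_mul, tensorOp_mul]
  congr 1; funext l; split_ifs <;> simp

theorem commute_mul_of_anticomm {R : Type*} [Ring R] {p a b : R} (ha : p * a = -(a * p))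
    (hb : p * b = -(b * p)) : Commute p (a * b) := by
  rw [Commute, SemiconjBy, ← mul_assoc, ha, neg_mul, mul_assoc, hb, mul_neg, neg_neg, mul_assoc]

/-- Each coupling has exactly two factors that anticommute with the parity, and otherwise only σ^z.
-/
theorem parityOp_commute_hamiltonian (n : ℕ) (J φ : ℝ) :
    Commute (parityOp N) (hamiltonian N n J φ) := by
  rcases Nat.eq_zero_or_pos N with rfl | hN
  · simp [hamiltonian]
  have : NeZero N := ⟨hN.ne'⟩
  have hx := parityOp_anticomm_siteOp (N := N) (m := σx)
    (by rw [σz_mul_σx, σx_mul_σz, neg_neg])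
  have hy := parityOp_anticomm_siteOp (N := N) (m := σy)
    (by rw [σz_mul_σy, σy_mul_σz])
  have hz : ∀ n j, Commute (parityOp N) (clusterZ N n j) := fun n j => by
    induction n with
    | zero => simp [clusterZ]
    | succ n ih => rw [clusterZ_succ]; exact ih.mul_right (parityOp_commute_siteOp_σz _)
  rw [hamiltonian_eq]
  refine Commute.smul_right (Commute.sub_right (Commute.smul_right (Commute.sum_right _ _ _ ?_) _)
    (Commute.smul_right (Commute.sum_right _ _ _ ?_) _)) _
  · intro j _
    exact commute_mul_of_anticomm (hy _) (hy _)
  · intro j _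
    refine commute_mul_of_anticomm ?_ (hx _)
    rw [← mul_assoc, hx, neg_mul, mul_assoc, (hz n j).eq, mul_assoc]

end Parity

end ClusterIsing

namespace ClusterIsing

open Matrix

open scoped ComplexOrder

variable {N : ℕ}

/-! ### The lowest eigenvalue and the variational principle -/

section GroundEnergy

theorem toEnd_apply (X : Op N) (v : EuclideanSpace ℂ (Fin N → Fin 2)) :
    toEnd X v = WithLp.toLp 2 (X *ᵥ v.ofLp) := rfl

theorem toEnd_eq_smul_iff (X : Op N) (c : ℂ) (v : EuclideanSpace ℂ (Fin N → Fin 2)) :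
    toEnd X v = c • v ↔ X *ᵥ v.ofLp = c • v.ofLp := by
  rw [toEnd_apply]
  constructor
  · intro h
    have := congrArg WithLp.ofLp h
    simpa using this
  · intro h
    rw [h]
    rfl

variable {n : ℕ} {J φ : ℝ}

theorem hasEigenvalue_eigenvalues_add (H : Op N) (E : ℝ) (hA : (H - (E : ℂ) • 1).IsHermitian)
    (i : Fin N → Fin 2) :
    Module.End.HasEigenvalue (toEnd H) ((hA.eigenvalues i + E : ℝ) : ℂ) := by
  have h := hA.mulVec_eigenvectorBasis i
  refine Module.End.hasEigenvalue_of_hasEigenvector (x := hA.eigenvectorBasis i) ⟨?_, ?_⟩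
  · rw [Module.End.mem_eigenspace_iff, toEnd_eq_smul_iff]
    rw [Matrix.sub_mulVec, Matrix.smul_mulVec, Matrix.one_mulVec, sub_eq_iff_eq_add] at h
    rw [h]
    ext s
    simp [add_mul]
  · exact hA.eigenvectorBasis.orthonormal.ne_zero i

theorem finite_setOf_hasEigenvalue (H : Op N) :
    {E : ℝ | Module.End.HasEigenvalue (toEnd H) (E : ℂ)}.Finite := by
  have h : (spectrum ℂ (toEnd H)).Finite := Module.End.finite_spectrum _
  refine (h.preimage (f := ((↑) : ℝ → ℂ)) Complex.ofReal_injective.injOn).subset ?_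
  intro E hE
  exact (Module.End.hasEigenvalue_iff_mem_spectrum).1 hE

theorem isHermitian_sub_smul {H : Op N} (hH : H.IsHermitian) (E : ℝ) :
    (H - (E : ℂ) • 1).IsHermitian := by
  rw [Matrix.IsHermitian, Matrix.conjTranspose_sub, Matrix.conjTranspose_smul, hH.eq]
  simp

/-- The infimum is attained because the set of eigenvalues is finite and nonempty; the spectral
theorem supplies an element. -/
theorem groundEnergy_hasEigenvalue (hN : n + 2 ≤ N) :
    Module.End.HasEigenvalue (toEnd (hamiltonian N n J φ)) (groundEnergy N n J φ : ℂ) := by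
  refine Set.Nonempty.csInf_mem ?_ (finite_setOf_hasEigenvalue (hamiltonian N n J φ))
  exact ⟨_, hasEigenvalue_eigenvalues_add (hamiltonian N n J φ) 0
    (isHermitian_sub_smul (hamiltonian_conjTranspose hN J φ) 0) (fun _ => 0)⟩

theorem posSemidef_hamiltonian_sub (hN : n + 2 ≤ N) :
    (hamiltonian N n J φ - (groundEnergy N n J φ : ℂ) • 1).PosSemidef := by
  have hA := isHermitian_sub_smul (hamiltonian_conjTranspose hN J φ) (groundEnergy N n J φ)
  refine hA.posSemidef_iff_eigenvalues_nonneg.2 fun i => ?_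
  have h : groundEnergy N n J φ ≤ _ := csInf_le
    (finite_setOf_hasEigenvalue (hamiltonian N n J φ)).bddBelow
    (hasEigenvalue_eigenvalues_add _ _ hA i)
  simpa using h

end GroundEnergy

/-! ### The ground projection and its symmetries -/

section GroundProjection

variable (N) in
/-- The matrix of the orthogonal projection onto the space of ground states. -/
noncomputable def groundProj (n : ℕ) (J φ : ℝ) : Op N :=
  Matrix.toEuclideanLin.symm ((groundSpace N n J φ).starProjection :
    EuclideanSpace ℂ (Fin N → Fin 2) →ₗ[ℂ] EuclideanSpace ℂ (Fin N → Fin 2))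

variable {n : ℕ} {J φ : ℝ}

theorem toEnd_groundProj : toEnd (groundProj N n J φ) =
    ((groundSpace N n J φ).starProjection :
      EuclideanSpace ℂ (Fin N → Fin 2) →ₗ[ℂ] EuclideanSpace ℂ (Fin N → Fin 2)) :=
  Matrix.toEuclideanLin.apply_symm_apply _

theorem toEnd_mul (X Y : Op N) : toEnd (X * Y) = toEnd X ∘ₗ toEnd Y :=
  Matrix.toLpLin_mul 2 2 2 X Y

theorem toEnd_injective : Function.Injective (toEnd (N := N)) :=
  Matrix.toEuclideanLin.injective

theorem toEnd_smul (c : ℂ) (X : Op N) : toEnd (c • X) = c • toEnd X :=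
  map_smul Matrix.toEuclideanLin c X

theorem trace_toEnd (X : Op N) : LinearMap.trace ℂ _ (toEnd X) = X.trace := by
  rw [toEnd, Matrix.toEuclideanLin_eq_toLin_orthonormal]
  exact Matrix.trace_toLin_eq X _

theorem groundProj_mul_self : groundProj N n J φ * groundProj N n J φ = groundProj N n J φ := by
  apply toEnd_injective
  rw [toEnd_mul, toEnd_groundProj]
  ext1 v
  exact congrArg (· v) (groundSpace N n J φ).isIdempotentElem_starProjection.eq

theorem groundProj_conjTranspose : (groundProj N n J φ)ᴴ = groundProj N n J φ := by
  refine Matrix.isSymmetric_toEuclideanLin_iff.1 ?_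
  have := (groundSpace N n J φ).starProjection_isSymmetric
  rwa [← toEnd_groundProj] at this

theorem hamiltonian_mul_groundProj : hamiltonian N n J φ * groundProj N n J φ =
    (groundEnergy N n J φ : ℂ) • groundProj N n J φ := by
  apply toEnd_injective
  rw [toEnd_mul, toEnd_smul, toEnd_groundProj]
  ext1 v
  exact Module.End.mem_eigenspace_iff.1 ((groundSpace N n J φ).starProjection_apply_mem v)

theorem groundProj_mul_of_eigen {M : Op N}
    (h : hamiltonian N n J φ * M = (groundEnergy N n J φ : ℂ) • M) :
    groundProj N n J φ * M = M := by
  apply toEnd_injective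
  ext1 v
  rw [toEnd_mul, toEnd_groundProj]
  refine Submodule.starProjection_eq_self_iff.2 (Module.End.mem_eigenspace_iff.2 ?_)
  have : toEnd (hamiltonian N n J φ * M) v = toEnd ((groundEnergy N n J φ : ℂ) • M) v := by rw [h]
  rw [toEnd_mul, toEnd_smul] at this
  exact this

theorem trace_groundProj : (groundProj N n J φ).trace =
    (Module.finrank ℂ (groundSpace N n J φ) : ℂ) := by
  rw [← trace_toEnd, toEnd_groundProj]
  refine LinearMap.IsProj.trace (p := groundSpace N n J φ) ⟨?_, ?_⟩
  · intro x; exact (groundSpace N n J φ).starProjection_apply_mem x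
  · intro x hx; exact Submodule.starProjection_eq_self_iff.2 hx

theorem finrank_groundSpace_pos (hN : n + 2 ≤ N) : 0 < Module.finrank ℂ (groundSpace N n J φ) := by
  have h := groundEnergy_hasEigenvalue (J := J) (φ := φ) hN
  rw [Module.finrank_pos_iff, Submodule.nontrivial_iff_ne_bot]
  exact h

theorem expect_eq (X : Op N) : expect N n J φ X =
    (groundProj N n J φ * X).trace / (Module.finrank ℂ (groundSpace N n J φ) : ℂ) := by
  rw [expect, ← toEnd_groundProj, ← toEnd_mul, trace_toEnd]

/-- Both $U$ and $U^\dagger$ preserve the ground space, so $PUP=UP$ and $PU^\dagger P=U^\dagger P$;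
the adjoint of the second identity is $PUP=PU$. -/
theorem commute_groundProj {U V : Op N} (hUV : Uᴴ = V) (hU : Commute U (hamiltonian N n J φ))
    (hV : Commute V (hamiltonian N n J φ)) : Commute U (groundProj N n J φ) := by
  have key : ∀ W : Op N, Commute W (hamiltonian N n J φ) →
      groundProj N n J φ * (W * groundProj N n J φ) = W * groundProj N n J φ := fun W hW =>
    groundProj_mul_of_eigen (by
      rw [← mul_assoc, ← hW.eq, mul_assoc, hamiltonian_mul_groundProj, Matrix.mul_smul])
  have h1 := key U hU
  have h2 := congrArg Matrix.conjTranspose (key V hV)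
  simp only [Matrix.conjTranspose_mul, groundProj_conjTranspose, ← hUV,
    Matrix.conjTranspose_conjTranspose] at h2
  rw [Commute, SemiconjBy, ← h1, ← mul_assoc, h2]

/-- Since $H$ is symmetric, the columns of $P^T$ are ground vectors, so $PP^T=P^T$. The left side is
symmetric, hence $P^T=P$. -/
theorem groundProj_transpose (hN : n + 2 ≤ N) : (groundProj N n J φ)ᵀ = groundProj N n J φ := by
  have hq : ((groundProj N n J φ)ᵀ)ᴴ = (groundProj N n J φ)ᵀ := by
    rw [Matrix.conjTranspose_transpose_eq_transpose_conjTranspose, groundProj_conjTranspose]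
  have hc : (groundProj N n J φ * hamiltonian N n J φ) =
      (groundEnergy N n J φ : ℂ) • groundProj N n J φ := by
    have := congrArg Matrix.conjTranspose (hamiltonian_mul_groundProj (N := N) (n := n) (J := J)
      (φ := φ))
    rwa [Matrix.conjTranspose_mul, Matrix.conjTranspose_smul, groundProj_conjTranspose,
      hamiltonian_conjTranspose hN, Complex.star_def, Complex.conj_ofReal] at this
  have h1 : groundProj N n J φ * (groundProj N n J φ)ᵀ = (groundProj N n J φ)ᵀ := by
    apply groundProj_mul_of_eigen
    have := congrArg Matrix.transpose hc
    rwa [Matrix.transpose_mul, hamiltonian_transpose hN, Matrix.transpose_smul] at this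
  have h2 : groundProj N n J φ * (groundProj N n J φ)ᵀ = groundProj N n J φ := by
    have := congrArg Matrix.transpose h1
    simpa [Matrix.transpose_mul] using this
  rw [← h1, h2]

end GroundProjection

/-! ### States, Cauchy–Schwarz bounds, and the ground state -/

section States

/-- States: normalized positive linear functionals on the operators. -/
structure IsState (ω : Op N →ₗ[ℂ] ℂ) : Prop where
  map_one : ω 1 = 1
  map_conjTranspose : ∀ X, ω Xᴴ = (starRingEnd ℂ) (ω X)
  nonneg : ∀ X, 0 ≤ (ω (Xᴴ * X)).re

theorem IsState.re_add_le {ω : Op N →ₗ[ℂ] ℂ} (hω : IsState ω) (X Y : Op N) :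
    2 * (ω (Xᴴ * Y)).re ≤ (ω (Xᴴ * X)).re + (ω (Yᴴ * Y)).re := by
  have h := hω.nonneg (X - Y)
  have h1 : ω (Yᴴ * X) = (starRingEnd ℂ) (ω (Xᴴ * Y)) := by
    rw [← hω.map_conjTranspose, Matrix.conjTranspose_mul, Matrix.conjTranspose_conjTranspose]
  rw [Matrix.conjTranspose_sub, Matrix.sub_mul, Matrix.mul_sub, Matrix.mul_sub, map_sub, map_sub,
    map_sub, h1] at h
  simp only [Complex.sub_re, Complex.conj_re] at h
  linarith

/-- Cauchy–Schwarz in arithmetic-mean form, which avoids square roots; rescaling $X$ gives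
`IsState.norm_le_scaled`. -/
theorem IsState.norm_le {ω : Op N →ₗ[ℂ] ℂ} (hω : IsState ω) (X Y : Op N) :
    ‖ω (Xᴴ * Y)‖ ≤ ((ω (Xᴴ * X)).re + (ω (Yᴴ * Y)).re) / 2 := by
  set z := ω (Xᴴ * Y) with hz
  rcases eq_or_ne z 0 with h0 | h0
  · rw [h0, norm_zero]
    have := hω.nonneg X
    have := hω.nonneg Y
    positivity
  have hn : (‖z‖ : ℂ) ≠ 0 := by simpa using h0
  -- The phase that rotates $\omega(X^\dagger Y)$ onto the positive real axis.
  set c : ℂ := (starRingEnd ℂ) z / ‖z‖ with hc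
  have hcc : (starRingEnd ℂ) c * c = 1 := by
    rw [hc, map_div₀, Complex.conj_conj, Complex.conj_ofReal, div_mul_div_comm, Complex.mul_conj,
      Complex.normSq_eq_norm_sq]
    push_cast
    field_simp
  have h := hω.re_add_le X (c • Y)
  have h1 : ω (Xᴴ * c • Y) = ‖z‖ := by
    rw [Matrix.mul_smul, map_smul, ← hz, hc, smul_eq_mul, div_mul_eq_mul_div, mul_comm _ z,
      Complex.mul_conj, Complex.normSq_eq_norm_sq]
    push_cast
    field_simp
  have h2 : ω ((c • Y)ᴴ * c • Y) = ω (Yᴴ * Y) := by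
    rw [Matrix.conjTranspose_smul, Matrix.smul_mul, Matrix.mul_smul, smul_smul, Complex.star_def,
      hcc, one_smul]
  rw [h1, h2, Complex.ofReal_re] at h
  linarith

theorem IsState.norm_le_scaled {ω : Op N →ₗ[ℂ] ℂ} (hω : IsState ω) (X Y : Op N) {t : ℝ}
    (ht : 0 < t) :
    ‖ω (Xᴴ * Y)‖ ≤ (t * (ω (Xᴴ * X)).re + t⁻¹ * (ω (Yᴴ * Y)).re) / 2 := by
  have h := hω.norm_le ((t : ℂ) • X) Y
  simp only [Matrix.conjTranspose_smul, Matrix.smul_mul, Matrix.mul_smul, map_smul,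
    Complex.star_def, Complex.conj_ofReal, smul_eq_mul, norm_mul, Complex.norm_real,
    Real.norm_of_nonneg ht.le, Complex.re_ofReal_mul] at h
  calc ‖ω (Xᴴ * Y)‖ = t⁻¹ * (t * ‖ω (Xᴴ * Y)‖) := by field_simp
    _ ≤ t⁻¹ * ((t * (t * (ω (Xᴴ * X)).re) + (ω (Yᴴ * Y)).re) / 2) := by gcongr
    _ = _ := by field_simp

theorem IsState.norm_le_one {ω : Op N →ₗ[ℂ] ℂ} (hω : IsState ω) {T : Op N} (h1 : Tᴴ * T = 1) :
    ‖ω T‖ ≤ 1 := by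
  have h := hω.norm_le 1 T
  rw [h1, Matrix.conjTranspose_one, one_mul, one_mul, hω.map_one] at h
  simpa using h

/-- The ground-state expectation as a linear functional. -/
noncomputable def groundState (N n : ℕ) (J φ : ℝ) : Op N →ₗ[ℂ] ℂ where
  toFun := expect N n J φ
  map_add' X Y := by simp only [expect_eq, Matrix.mul_add, Matrix.trace_add, add_div]
  map_smul' c X := by
    simp only [expect_eq, Matrix.mul_smul, Matrix.trace_smul, smul_eq_mul, mul_div_assoc,
      RingHom.id_apply]

variable {n : ℕ} {J φ : ℝ}

theorem groundState_apply (X : Op N) : groundState N n J φ X = expect N n J φ X := rfl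

theorem isState_groundState (hN : n + 2 ≤ N) : IsState (groundState N n J φ) := by
  have hpos := finrank_groundSpace_pos (J := J) (φ := φ) hN
  refine ⟨?_, ?_, ?_⟩
  · rw [groundState_apply, expect_eq, mul_one, trace_groundProj]
    exact div_self (by exact_mod_cast hpos.ne')
  · intro X
    rw [groundState_apply, groundState_apply, expect_eq, expect_eq, map_div₀, Complex.conj_natCast]
    congr 1
    rw [← Complex.star_def, ← Matrix.trace_conjTranspose, Matrix.conjTranspose_mul,
      groundProj_conjTranspose, Matrix.trace_mul_comm]
  · intro X
    rw [groundState_apply, expect_eq, Complex.div_natCast_re]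
    refine div_nonneg ?_ (Nat.cast_nonneg _)
    have h : (groundProj N n J φ * (Xᴴ * X)).trace =
        ((X * groundProj N n J φ)ᴴ * (X * groundProj N n J φ)).trace := by
      rw [Matrix.conjTranspose_mul, groundProj_conjTranspose]
      conv_rhs => rw [← mul_assoc, Matrix.trace_mul_comm]
      simp only [← mul_assoc, groundProj_mul_self]
    rw [h]
    exact (Complex.le_def.1 (Matrix.posSemidef_conjTranspose_mul_self _).trace_nonneg).1

theorem groundState_hamiltonian (hN : n + 2 ≤ N) :
    groundState N n J φ (hamiltonian N n J φ) = groundEnergy N n J φ := by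
  have hpos := finrank_groundSpace_pos (J := J) (φ := φ) hN
  rw [groundState_apply, expect_eq, Matrix.trace_mul_comm, hamiltonian_mul_groundProj,
    Matrix.trace_smul, trace_groundProj, smul_eq_mul]
  exact mul_div_cancel_right₀ _ (by exact_mod_cast hpos.ne')

theorem groundState_transpose (hN : n + 2 ≤ N) (X : Op N) :
    groundState N n J φ Xᵀ = groundState N n J φ X := by
  rw [groundState_apply, groundState_apply, expect_eq, expect_eq]
  congr 1
  conv_rhs => rw [← Matrix.trace_transpose, Matrix.transpose_mul, groundProj_transpose hN,
    Matrix.trace_mul_comm]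

theorem groundState_conj {U V : Op N} (hUV : Uᴴ = V) (hVU : V * U = 1)
    (hU : Commute U (hamiltonian N n J φ)) (hV : Commute V (hamiltonian N n J φ)) (X : Op N) :
    groundState N n J φ (U * X * V) = groundState N n J φ X := by
  rw [groundState_apply, groundState_apply, expect_eq, expect_eq]
  congr 1
  rw [mul_assoc, ← mul_assoc, ← (commute_groundProj hUV hU hV).eq, mul_assoc, Matrix.trace_mul_comm,
    mul_assoc, mul_assoc, hVU, mul_one]

theorem groundEnergy_le (hN : n + 2 ≤ N) (ψ : (Fin N → Fin 2) → ℂ) :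
    groundEnergy N n J φ * (star ψ ⬝ᵥ ψ).re ≤ (star ψ ⬝ᵥ hamiltonian N n J φ *ᵥ ψ).re := by
  have h := (posSemidef_hamiltonian_sub (J := J) (φ := φ) hN).dotProduct_mulVec_nonneg ψ
  rw [Matrix.sub_mulVec, dotProduct_sub, Matrix.smul_mulVec, Matrix.one_mulVec, dotProduct_smul]
    at h
  have := (Complex.le_def.1 h).1
  simp only [Complex.zero_re, Complex.sub_re, smul_eq_mul, Complex.re_ofReal_mul] at this
  linarith

end States

/-! ### Selection rules for Pauli strings -/

section Selection

variable {n : ℕ} {J φ : ℝ}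

theorem pauli_transpose (a : Fin 4) : (pauli a)ᵀ = (if a = 2 then (-1 : ℂ) else 1) • pauli a := by
  fin_cases a <;> simp [pauli, σx_transpose, σy_transpose, σz_transpose]

theorem σz_conj_pauli (a : Fin 4) : σz * pauli a * σz =
    ((if a = 1 then (-1 : ℂ) else 1) * (if a = 2 then (-1 : ℂ) else 1)) • pauli a := by
  fin_cases a <;> ext i j <;> fin_cases i <;> fin_cases j <;> simp [pauli, σx, σy, σz]

/-- Transposition multiplies the string by $(-1)^{\#y}$ and conjugation by the parity by
$(-1)^{\#x+\#y}$. If $\#y$ is even and $\#x$ odd, the second sign is $-1$. -/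
theorem groundState_pauli_eq_zero (hN : n + 2 ≤ N) (w : Fin N → Fin 4)
    (hw : Odd (Finset.univ.filter fun l => w l = 1).card ∨
      Odd (Finset.univ.filter fun l => w l = 2).card) :
    groundState N n J φ (tensorOp fun l => pauli (w l)) = 0 := by
  have hcount : ∀ a : Fin 4, ∏ l : Fin N, (if w l = a then (-1 : ℂ) else 1) =
      (-1) ^ (Finset.univ.filter fun l => w l = a).card := fun a => by
    rw [Finset.prod_ite]; simp
  set W : Op N := tensorOp fun l => pauli (w l) with hW
  have hy : Odd (Finset.univ.filter fun l => w l = 2).card → groundState N n J φ W = 0 := by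
    intro h
    have h1 := groundState_transpose (J := J) (φ := φ) hN W
    have h2 : Wᵀ = (-1 : ℂ) • W := by
      rw [hW, tensorOp_transpose]
      simp only [pauli_transpose]
      rw [tensorOp_smul, hcount 2, h.neg_one_pow]
    rw [h2, map_smul, smul_eq_mul] at h1
    linear_combination (-1 / 2 : ℂ) * h1
  rcases Nat.even_or_odd (Finset.univ.filter fun l => w l = 2).card with he | ho
  · have h := hw.resolve_right (Nat.not_odd_iff_even.2 he)
    have hp : (parityOp N)ᴴ = parityOp N := by
      rw [parityOp, tensorOp_conjTranspose]; simp only [σz_conjTranspose]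
    have hc := parityOp_commute_hamiltonian (N := N) n J φ
    have h1 := groundState_conj hp parityOp_mul_self hc hc W
    have h2 : parityOp N * W * parityOp N = (-1 : ℂ) • W := by
      rw [hW, parityOp, tensorOp_mul, tensorOp_mul]
      simp only [σz_conj_pauli]
      rw [tensorOp_smul, Finset.prod_mul_distrib, hcount 1, hcount 2, h.neg_one_pow,
        he.neg_one_pow, mul_one]
    rw [h2, map_smul, smul_eq_mul] at h1
    linear_combination (-1 / 2 : ℂ) * h1
  · exact hy ho

end Selection

end ClusterIsing

namespace ClusterIsing

open Matrix

variable {N : ℕ}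

/-! ### Jordan–Wigner (Majorana) operators and their anticommutation relations -/

section Majoranas

/-- The factors of a Jordan–Wigner operator: `σ^z` on the sites before `j`, and `m` on the site `j`. -/
def jwFactor (N : ℕ) (m : Matrix (Fin 2) (Fin 2) ℂ) (j : ℕ) (l : Fin N) :
    Matrix (Fin 2) (Fin 2) ℂ :=
  if (l : ℕ) < j then σz else if (l : ℕ) = j then m else 1

theorem siteOp_apply [NeZero N] (m : Matrix (Fin 2) (Fin 2) ℂ) (j : ℕ) (s t : Fin N → Fin 2) :
    siteOp N m j s t =
      m (s ⟨j % N, Nat.mod_lt _ (NeZero.pos N)⟩) (t ⟨j % N, Nat.mod_lt _ (NeZero.pos N)⟩) *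
      ∏ l ∈ Finset.univ.erase (⟨j % N, Nat.mod_lt _ (NeZero.pos N)⟩ : Fin N),
        (1 : Matrix (Fin 2) (Fin 2) ℂ) (s l) (t l) := by
  rw [siteOp, tensorOp, Matrix.of_apply, ← Finset.mul_prod_erase _ _ (Finset.mem_univ
    (⟨j % N, Nat.mod_lt _ (NeZero.pos N)⟩ : Fin N))]
  congr 1
  · simp
  · refine Finset.prod_congr rfl fun l hl => ?_
    have : ¬ (l : ℕ) = j % N := fun h => Finset.ne_of_mem_erase hl (Fin.ext h)
    simp [this]

theorem siteOp_add [NeZero N] (m m' : Matrix (Fin 2) (Fin 2) ℂ) (j : ℕ) :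
    siteOp N (m + m') j = siteOp N m j + siteOp N m' j := by
  ext s t
  simp only [Matrix.add_apply, siteOp_apply, add_mul]

theorem siteOp_sub [NeZero N] (m m' : Matrix (Fin 2) (Fin 2) ℂ) (j : ℕ) :
    siteOp N (m - m') j = siteOp N m j - siteOp N m' j := by
  ext s t
  simp only [Matrix.sub_apply, siteOp_apply, sub_mul]

theorem jwString_eq {j : ℕ} (hj : j ≤ N) :
    jwString N j = tensorOp fun l => if (l : ℕ) < j then σz else 1 := by
  induction j with
  | zero => simp [jwString, tensorOp_one]
  | succ j ih =>
    have h : jwString N (j + 1) = jwString N j * siteOp N σz j := by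
      simp [jwString, List.range_succ]
    rw [h, ih (by omega), siteOp, tensorOp_mul]
    congr 1; funext l
    rw [Nat.mod_eq_of_lt (by omega : j < N)]
    rcases lt_trichotomy (l : ℕ) j with h | h | h
    · simp [h, h.ne, h.trans (Nat.lt_succ_self j)]
    · simp [h]
    · simp [h.ne', h.not_gt, show ¬ (l : ℕ) < j + 1 by omega]

theorem jwString_mul_siteOp (m : Matrix (Fin 2) (Fin 2) ℂ) {j : ℕ} (hj : j < N) :
    jwString N j * siteOp N m j = tensorOp (jwFactor N m j) := by
  rw [jwString_eq hj.le, siteOp, tensorOp_mul]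
  congr 1; funext l
  rw [Nat.mod_eq_of_lt hj, jwFactor]
  rcases lt_trichotomy (l : ℕ) j with h | h | h
  · simp [h, h.ne]
  · simp [h]
  · simp [h.ne', h.not_gt]

theorem opA_eq {j : ℕ} (hj : j < N) : opA N j = tensorOp (jwFactor N σx j) := by
  have : NeZero N := ⟨by omega⟩
  rw [opA, fermi, fermiDag, ← mul_add, ← siteOp_add, add_σminus_σplus, jwString_mul_siteOp _ hj]

theorem opB_eq {j : ℕ} (hj : j < N) : opB N j = (-Complex.I) • tensorOp (jwFactor N σy j) := by
  have : NeZero N := ⟨by omega⟩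
  rw [opB, fermi, fermiDag, ← mul_sub, ← siteOp_sub, sub_σminus_σplus, ← neg_smul, siteOp_smul,
    Matrix.mul_smul, jwString_mul_siteOp _ hj]

/-- The factors fail to commute only on site $i$, where $m$ meets the σ^z of the longer string. -/
theorem jwFactor_anticomm_of_lt {m m' : Matrix (Fin 2) (Fin 2) ℂ} (hm : m * σz = -(σz * m))
    {i j : ℕ} (hij : i < j) (hj : j < N) :
    tensorOp (jwFactor N m i) * tensorOp (jwFactor N m' j) =
      -(tensorOp (jwFactor N m' j) * tensorOp (jwFactor N m i)) := by
  refine tensorOp_anticomm ⟨i, by omega⟩ (by simp [jwFactor, hij, hm]) fun l hl => ?_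
  have hl' : (l : ℕ) ≠ i := fun h => hl (Fin.ext h)
  by_cases h : (l : ℕ) < i
  · simp [jwFactor, h, h.trans hij]
  · simp [jwFactor, h, hl']

theorem jwFactor_anticomm_of_ne {m m' : Matrix (Fin 2) (Fin 2) ℂ} (hm : m * σz = -(σz * m))
    (hm' : m' * σz = -(σz * m')) {i j : ℕ} (hij : i ≠ j) (hi : i < N) (hj : j < N) :
    tensorOp (jwFactor N m i) * tensorOp (jwFactor N m' j) =
      -(tensorOp (jwFactor N m' j) * tensorOp (jwFactor N m i)) := by
  rcases lt_or_gt_of_ne hij with h | h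
  · exact jwFactor_anticomm_of_lt hm h hj
  · rw [jwFactor_anticomm_of_lt (m := m') (m' := m) hm' h hi, neg_neg]

theorem jwFactor_anticomm_self {m m' : Matrix (Fin 2) (Fin 2) ℂ} (hm : m * m' = -(m' * m))
    {j : ℕ} (hj : j < N) :
    tensorOp (jwFactor N m j) * tensorOp (jwFactor N m' j) =
      -(tensorOp (jwFactor N m' j) * tensorOp (jwFactor N m j)) := by
  refine tensorOp_anticomm ⟨j, hj⟩ (by simp [jwFactor, hm]) fun l hl => ?_
  have hl' : (l : ℕ) ≠ j := fun h => hl (Fin.ext h)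
  simp [jwFactor, hl']

theorem jwFactor_mul_self {m : Matrix (Fin 2) (Fin 2) ℂ} (hm : m * m = 1) (j : ℕ) :
    tensorOp (jwFactor N m j) * tensorOp (jwFactor N m j) = 1 := by
  rw [tensorOp_mul, ← tensorOp_one]
  congr 1; funext l
  unfold jwFactor
  split_ifs <;> simp [hm, σz_mul_self]

theorem jwFactor_conjTranspose {m : Matrix (Fin 2) (Fin 2) ℂ} (hm : mᴴ = m) (j : ℕ) :
    (tensorOp (jwFactor N m j))ᴴ = tensorOp (jwFactor N m j) := by
  rw [tensorOp_conjTranspose]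
  congr 1; funext l
  unfold jwFactor
  split_ifs <;> simp [hm, σz_conjTranspose]

theorem σx_σz_anticomm : σx * σz = -(σz * σx) := by rw [σx_mul_σz, σz_mul_σx]
theorem σy_σz_anticomm : σy * σz = -(σz * σy) := by rw [σy_mul_σz, σz_mul_σy, neg_neg]

theorem opA_mul_self {j : ℕ} (hj : j < N) : opA N j * opA N j = 1 := by
  rw [opA_eq hj, jwFactor_mul_self σx_mul_self]

theorem opB_mul_self {j : ℕ} (hj : j < N) : opB N j * opB N j = -1 := by
  rw [opB_eq hj, Matrix.smul_mul, Matrix.mul_smul, jwFactor_mul_self σy_mul_self, smul_smul]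
  simp

theorem opA_anticomm_opA {i j : ℕ} (hi : i < N) (hj : j < N) (h : i ≠ j) :
    opA N i * opA N j = -(opA N j * opA N i) := by
  rw [opA_eq hi, opA_eq hj, jwFactor_anticomm_of_ne σx_σz_anticomm σx_σz_anticomm h hi hj]

theorem opB_anticomm_opB {i j : ℕ} (hi : i < N) (hj : j < N) (h : i ≠ j) :
    opB N i * opB N j = -(opB N j * opB N i) := by
  simp only [opB_eq hi, opB_eq hj, Matrix.smul_mul, Matrix.mul_smul]
  rw [jwFactor_anticomm_of_ne σy_σz_anticomm σy_σz_anticomm h hi hj]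
  simp only [smul_neg]

theorem opB_anticomm_opA {i j : ℕ} (hi : i < N) (hj : j < N) :
    opB N i * opA N j = -(opA N j * opB N i) := by
  simp only [opB_eq hi, opA_eq hj, Matrix.smul_mul, Matrix.mul_smul]
  rw [← smul_neg]
  congr 1
  rcases eq_or_ne i j with rfl | h
  · exact jwFactor_anticomm_self (by rw [σy_mul_σx, σx_mul_σy]) hi
  · exact jwFactor_anticomm_of_ne σy_σz_anticomm σx_σz_anticomm h hi hj

theorem opA_conjTranspose {j : ℕ} (hj : j < N) : (opA N j)ᴴ = opA N j := by
  rw [opA_eq hj, jwFactor_conjTranspose σx_conjTranspose]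

theorem opB_conjTranspose {j : ℕ} (hj : j < N) : (opB N j)ᴴ = -opB N j := by
  rw [opB_eq hj, Matrix.conjTranspose_smul, jwFactor_conjTranspose σy_conjTranspose]
  simp

theorem opA_transpose {j : ℕ} (hj : j < N) : (opA N j)ᵀ = opA N j := by
  rw [opA_eq hj, tensorOp_transpose]
  congr 1; funext l
  unfold jwFactor
  split_ifs <;> simp [σx_transpose, σz_transpose]

theorem opB_transpose {j : ℕ} (hj : j < N) : (opB N j)ᵀ = -opB N j := by
  rw [opB_eq hj, Matrix.transpose_smul, tensorOp_transpose, ← smul_neg]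
  congr 1
  rw [← neg_one_smul ℂ]
  refine tensorOp_eq_smul (-1) ⟨j, hj⟩ (by simp [jwFactor, σy_transpose]) fun l hl => ?_
  have hl' : (l : ℕ) ≠ j := fun h => hl (Fin.ext h)
  unfold jwFactor
  split_ifs <;> simp [σz_transpose]

/-- The strings cancel before $j$, and $\sigma^z\sigma^x=i\sigma^y$ on site $j$ absorbs the $-i$ in
$B$. Only bonds that do not wrap are covered. -/
theorem isingTerm_eq {j : ℕ} (hj : j + 1 < N) : isingTerm N j = opB N (j + 1) * opA N j := by
  have hj' : j < N := by omega
  rw [opB_eq hj, opA_eq hj', Matrix.smul_mul, tensorOp_mul, isingTerm, siteOp, siteOp,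
    Nat.mod_eq_of_lt hj, Nat.mod_eq_of_lt hj', tensorOp_mul]
  rw [tensorOp_eq_smul (M := fun l => jwFactor N σy (j + 1) l * jwFactor N σx j l)
    (M' := fun l : Fin N => (if (l : ℕ) = j then σy else 1) * (if (l : ℕ) = j + 1 then σy else 1))
    Complex.I ⟨j, hj'⟩, smul_smul]
  · simp
  · simp [jwFactor, σz_mul_σx]
  · intro l hl
    have hl' : (l : ℕ) ≠ j := fun h => hl (Fin.ext h)
    rcases lt_trichotomy (l : ℕ) (j + 1) with h | h | h
    · have h2 : (l : ℕ) < j := by omega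
      simp [jwFactor, hl', h, h2, h.ne, σz_mul_self]
    · simp [jwFactor, h]
    · have h2 : ¬ (l : ℕ) < j := by omega
      simp [jwFactor, hl', h.ne', h.not_gt, h2]

theorem clusterZ_eq {n j : ℕ} (h : j + n < N) :
    clusterZ N n j = tensorOp fun l => if j < (l : ℕ) ∧ (l : ℕ) ≤ j + n then σz else 1 := by
  induction n with
  | zero =>
    have : ∀ l : Fin N, ¬ (j < (l : ℕ) ∧ (l : ℕ) ≤ j + 0) := fun l => by omega
    simp only [this, if_false, tensorOp_one]
    simp [clusterZ]
  | succ n ih =>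
    rw [clusterZ_succ, ih (by omega), siteOp, Nat.mod_eq_of_lt (by omega), tensorOp_mul]
    congr 1; funext l
    by_cases h1 : (l : ℕ) = j + n + 1
    · have h2 : ¬ (j < (l : ℕ) ∧ (l : ℕ) ≤ j + n) := by omega
      have h3 : j < (l : ℕ) ∧ (l : ℕ) ≤ j + (n + 1) := by omega
      rw [if_neg h2, if_pos h3, if_pos h1, one_mul]
    · have h2 : (j < (l : ℕ) ∧ (l : ℕ) ≤ j + n) ↔ (j < (l : ℕ) ∧ (l : ℕ) ≤ j + (n + 1)) := by omega
      simp only [h1, h2, if_false, mul_one]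

/-- Here the uncancelled part of the longer string is the cluster's own σ^z string, and
$\sigma^y\sigma^z=i\sigma^x$ on site $j$. -/
theorem clusterTerm_eq {n j : ℕ} (hj : j + (n + 1) < N) :
    clusterTerm N n j = opB N j * opA N (j + (n + 1)) := by
  have hj' : j < N := by omega
  rw [opB_eq hj', opA_eq hj, Matrix.smul_mul, tensorOp_mul, clusterTerm, siteOp, siteOp,
    clusterZ_eq (by omega), add_assoc j n 1, Nat.mod_eq_of_lt hj, Nat.mod_eq_of_lt hj',
    tensorOp_mul, tensorOp_mul]
  rw [tensorOp_eq_smul (M := fun l => jwFactor N σy j l * jwFactor N σx (j + (n + 1)) l)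
    (M' := fun l : Fin N => (if (l : ℕ) = j then σx else 1) *
      (if j < (l : ℕ) ∧ (l : ℕ) ≤ j + n then σz else 1) *
      (if (l : ℕ) = j + (n + 1) then σx else 1))
    Complex.I ⟨j, hj'⟩, smul_smul]
  · simp
  · simp [jwFactor, σy_mul_σz]
  · intro l hl
    have hl' : (l : ℕ) ≠ j := fun h => hl (Fin.ext h)
    rcases lt_trichotomy (l : ℕ) (j + (n + 1)) with h | h | h
    · by_cases h2 : (l : ℕ) < j
      · have h3 : ¬ (j < (l : ℕ)) := by omega
        simp [jwFactor, hl', h, h2, h.ne, σz_mul_self, h3]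
      · have h3 : j < (l : ℕ) ∧ (l : ℕ) ≤ j + n := by omega
        simp [jwFactor, hl', h, h2, h.ne, h3]
    · simp [jwFactor, h]
    · have h2 : ¬ (l : ℕ) < j := by omega
      have h3 : ¬ (l : ℕ) ≤ j + n := by omega
      simp [jwFactor, hl', h.ne', h.not_gt, h2, h3]

theorem siteOp_σz_eq {j : ℕ} (hj : j < N) : siteOp N σz j = opA N j * opB N j := by
  rw [opB_eq hj, opA_eq hj, Matrix.mul_smul, tensorOp_mul, siteOp, Nat.mod_eq_of_lt hj]
  rw [tensorOp_eq_smul (M := fun l => jwFactor N σx j l * jwFactor N σy j l)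
    (M' := fun l : Fin N => (if (l : ℕ) = j then σz else 1)) Complex.I ⟨j, hj⟩, smul_smul]
  · simp
  · simp [jwFactor, σx_mul_σy]
  · intro l hl
    have hl' : (l : ℕ) ≠ j := fun h => hl (Fin.ext h)
    by_cases h : (l : ℕ) < j <;> simp [jwFactor, hl', h, σz_mul_self]

end Majoranas

/-! ### Translation invariance -/

section Translation

/-- The cyclic shift of the configurations. -/
def shiftConfig (N : ℕ) : (Fin N → Fin 2) ≃ (Fin N → Fin 2) :=
  Equiv.arrowCongr (finRotate N).symm (Equiv.refl _)

/-- The translate of an operator by one site. -/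
def translate (X : Op N) : Op N := X.submatrix (shiftConfig N) (shiftConfig N)

theorem translate_mul (X Y : Op N) : translate (X * Y) = translate X * translate Y :=
  (Matrix.submatrix_mul_equiv _ _ _ _ _).symm

theorem translate_tensorOp {M M' : Fin N → Matrix (Fin 2) (Fin 2) ℂ}
    (h : ∀ l, M l = M' (finRotate N l)) : translate (tensorOp M) = tensorOp M' := by
  have := tensorOp_submatrix (finRotate N) M
  have hM : (fun l => M ((finRotate N).symm l)) = M' := by
    funext l; rw [h, Equiv.apply_symm_apply]
  rw [hM] at this
  exact this

theorem val_finRotate (l : Fin N) : ((finRotate N l : Fin N) : ℕ) = ((l : ℕ) + 1) % N := by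
  cases N with
  | zero => exact l.elim0
  | succ M => simp [finRotate_apply, Fin.val_add]

theorem translate_siteOp (m : Matrix (Fin 2) (Fin 2) ℂ) (j : ℕ) :
    translate (siteOp N m j) = siteOp N m (j + 1) := by
  refine translate_tensorOp fun l => ?_
  have : (((finRotate N l : Fin N) : ℕ) = (j + 1) % N) ↔ (l : ℕ) = j % N := by
    rw [val_finRotate]
    constructor
    · intro h
      have h2 : (l : ℕ) ≡ j [MOD N] := Nat.ModEq.add_right_cancel' 1 h
      rw [← h2, Nat.mod_eq_of_lt l.isLt]
    · intro h
      rw [h, Nat.mod_add_mod]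
  simp only [this]

theorem translate_clusterZ (n j : ℕ) : translate (clusterZ N n j) = clusterZ N n (j + 1) := by
  induction n with
  | zero =>
    simp only [clusterZ, List.range_zero, List.map_nil, List.prod_nil]
    exact Matrix.submatrix_one_equiv _
  | succ n ih =>
    rw [clusterZ_succ, clusterZ_succ, translate_mul, ih, translate_siteOp]
    congr 2
    omega

theorem sum_range_succ_of_periodic {M : Type*} [AddCommGroup M] (f : ℕ → M) (h : f N = f 0) :
    ∑ j ∈ Finset.range N, f (j + 1) = ∑ j ∈ Finset.range N, f j := by
  have h1 := Finset.sum_range_succ f N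
  rw [Finset.sum_range_succ', h] at h1
  exact add_right_cancel h1

theorem clusterZ_add_card (n j : ℕ) : clusterZ N n (j + N) = clusterZ N n j := by
  induction n with
  | zero => rfl
  | succ n ih =>
    rw [clusterZ_succ, clusterZ_succ, ih, show j + N + n + 1 = j + n + 1 + N by omega,
      siteOp_add_card]

theorem translate_hamiltonian (n : ℕ) (J φ : ℝ) :
    translate (hamiltonian N n J φ) = hamiltonian N n J φ := by
  have hsum : ∀ f : ℕ → Op N, translate (∑ j ∈ Finset.range N, f j) =
      ∑ j ∈ Finset.range N, translate (f j) := fun f => by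
    ext s t; simp [translate, Matrix.sum_apply]
  have hI : ∀ j, translate (isingTerm N j) = isingTerm N (j + 1) := fun j => by
    rw [isingTerm, translate_mul, translate_siteOp, translate_siteOp, isingTerm]
  have hC : ∀ j, translate (clusterTerm N n j) = clusterTerm N n (j + 1) := fun j => by
    rw [clusterTerm, translate_mul, translate_mul, translate_siteOp, translate_siteOp,
      translate_clusterZ, clusterTerm, show j + 1 + n + 1 = j + n + 1 + 1 by omega]
  have h1 : ∑ j ∈ Finset.range N, translate (isingTerm N j) =
      ∑ j ∈ Finset.range N, isingTerm N j := by
    simp only [hI]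
    refine sum_range_succ_of_periodic _ ?_
    have h0 := siteOp_add_card (N := N) σy 0
    have h1 := siteOp_add_card (N := N) σy 1
    rw [zero_add] at h0
    rw [isingTerm, isingTerm, h0, add_comm N 1, h1]
  have h2 : ∑ j ∈ Finset.range N, translate (clusterTerm N n j) =
      ∑ j ∈ Finset.range N, clusterTerm N n j := by
    simp only [hC]
    refine sum_range_succ_of_periodic _ ?_
    have h0 := siteOp_add_card (N := N) σx 0
    have h1 := siteOp_add_card (N := N) σx (0 + n + 1)
    have h2 := clusterZ_add_card (N := N) n 0
    rw [zero_add] at h0 h2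
    rw [clusterTerm, clusterTerm, h0, h2, show N + n + 1 = 0 + n + 1 + N by omega, h1]
  rw [hamiltonian_eq]
  conv_rhs => rw [← h1, ← h2, ← hsum, ← hsum]
  rfl

theorem groundState_translate {n : ℕ} {J φ : ℝ} (X : Op N) :
    groundState N n J φ (translate X) = groundState N n J φ X := by
  set U : Op N := (shiftConfig N).toPEquiv.toMatrix with hU
  set V : Op N := (shiftConfig N).symm.toPEquiv.toMatrix with hV
  have hconj : ∀ Y : Op N, U * Y * V = translate Y := fun Y => by
    rw [hU, hV, PEquiv.toMatrix_toPEquiv_mul, PEquiv.mul_toMatrix_toPEquiv]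
    rfl
  have hVU : V * U = 1 := by
    rw [hU, hV, ← PEquiv.toMatrix_trans, ← Equiv.toPEquiv_trans]
    simp [Equiv.toPEquiv_refl, PEquiv.toMatrix_refl]
  have hUV : Uᴴ = V := by
    ext s t
    simp only [hU, hV, Matrix.conjTranspose_apply, PEquiv.toMatrix_apply, Equiv.toPEquiv_apply,
      Option.mem_def, Option.some.injEq]
    by_cases h : s = (shiftConfig N) t
    · simp [h]
    · have h' : ¬ (shiftConfig N).symm s = t := fun h2 => h ((Equiv.symm_apply_eq _).1 h2)
      simp [h', Ne.symm h]
  have hH := hconj (hamiltonian N n J φ)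
  rw [translate_hamiltonian] at hH
  have hcV : V * hamiltonian N n J φ = hamiltonian N n J φ * V := by
    conv_lhs => rw [← hH]
    rw [← mul_assoc, ← mul_assoc, hVU, one_mul]
  have hcU : U * hamiltonian N n J φ = hamiltonian N n J φ * U := by
    conv_rhs => rw [← hH]
    rw [mul_assoc, hVU, mul_one]
  rw [← hconj]
  exact groundState_conj hUV hVU hcU hcV X

/-- A single $A_j$ or $B_i$ does not translate, since its string is anchored at site 0. In the
product the strings cancel outside the segment between $i$ and $j$, and this segment moves as a
whole. -/
theorem translate_opB_mul_opA {i j : ℕ} (hi : i + 1 < N) (hj : j + 1 < N) :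
    translate (opB N i * opA N j) = opB N (i + 1) * opA N (j + 1) := by
  rw [opB_eq (by omega), opB_eq hi, opA_eq (by omega), opA_eq hj, Matrix.smul_mul, Matrix.smul_mul,
    tensorOp_mul, tensorOp_mul]
  have : ∀ (c : ℂ) (X : Op N), translate (c • X) = c • translate X := fun _ _ => rfl
  rw [this]
  congr 1
  refine translate_tensorOp fun l => ?_
  simp only [jwFactor, val_finRotate]
  rcases Nat.lt_or_ge ((l : ℕ) + 1) N with h | h
  · rw [Nat.mod_eq_of_lt h]
    simp
  · have hl := l.isLt
    have h1 : (l : ℕ) + 1 = N := by omega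
    have h2 : ¬ (l : ℕ) < i ∧ ¬ (l : ℕ) < j ∧ ¬ (l : ℕ) = i ∧ ¬ (l : ℕ) = j := by omega
    -- The last site wraps to site 0: the original pair is trivial there, and the translated pair
    -- carries two σ^z, which cancel.
    simp [h1, h2, σz_mul_self]

theorem groundState_opB_opA_add {n : ℕ} {J φ : ℝ} {i j : ℕ} (m : ℕ) (hi : i + m < N)
    (hj : j + m < N) :
    groundState N n J φ (opB N (i + m) * opA N (j + m)) =
      groundState N n J φ (opB N i * opA N j) := by
  induction m with
  | zero => rfl
  | succ m ih =>
    rw [← ih (by omega) (by omega), ← add_assoc, ← add_assoc,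
      ← translate_opB_mul_opA (by omega) (by omega), groundState_translate]

theorem groundState_siteOp_siteOp_add {n : ℕ} {J φ : ℝ} (m m' : Matrix (Fin 2) (Fin 2) ℂ)
    (i j k : ℕ) :
    groundState N n J φ (siteOp N m (i + k) * siteOp N m' (j + k)) =
      groundState N n J φ (siteOp N m i * siteOp N m' j) := by
  induction k with
  | zero => rfl
  | succ k ih =>
    rw [← ih, ← add_assoc, ← add_assoc, ← translate_siteOp, ← translate_siteOp, ← translate_mul,
      groundState_translate]

theorem groundState_opB_opA_eq {n : ℕ} {J φ : ℝ} {i j i' j' : ℕ} (hi : i < N) (hj : j < N)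
    (hi' : i' < N) (hj' : j' < N) (h : (i : ℤ) - j = i' - j') :
    groundState N n J φ (opB N i * opA N j) = groundState N n J φ (opB N i' * opA N j') := by
  rcases Nat.le_total i i' with hle | hle
  · obtain ⟨m, rfl⟩ := Nat.exists_eq_add_of_le hle
    obtain rfl : j' = j + m := by omega
    exact (groundState_opB_opA_add m hi' hj').symm
  · obtain ⟨m, rfl⟩ := Nat.exists_eq_add_of_le hle
    obtain rfl : j = j' + m := by omega
    exact groundState_opB_opA_add m hi hj

end Translation

/-! ### Consequences of the reality of the Hamiltonian -/

section Reality

variable {n : ℕ} {J φ : ℝ}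

/-- Transposition reverses the product of the symmetric matrices $A_i,A_j$, and anticommutation then
gives a sign. For the antisymmetric $B$'s the two extra signs cancel. -/
theorem groundState_opA_opA (hN : n + 2 ≤ N) {i j : ℕ} (hi : i < N) (hj : j < N) (h : i ≠ j) :
    groundState N n J φ (opA N i * opA N j) = 0 := by
  have h1 := groundState_transpose (J := J) (φ := φ) hN (opA N i * opA N j)
  rw [Matrix.transpose_mul, opA_transpose hi, opA_transpose hj, opA_anticomm_opA hj hi h.symm,
    map_neg] at h1
  linear_combination (-1 / 2 : ℂ) * h1

theorem groundState_opB_opB (hN : n + 2 ≤ N) {i j : ℕ} (hi : i < N) (hj : j < N) (h : i ≠ j) :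
    groundState N n J φ (opB N i * opB N j) = 0 := by
  have h1 := groundState_transpose (J := J) (φ := φ) hN (opB N i * opB N j)
  rw [Matrix.transpose_mul, opB_transpose hi, opB_transpose hj, neg_mul_neg,
    opB_anticomm_opB hj hi h.symm, map_neg] at h1
  linear_combination (-1 / 2 : ℂ) * h1

theorem opB_mul_opA_unitary {i j : ℕ} (hi : i < N) (hj : j < N) :
    (opB N i * opA N j)ᴴ * (opB N i * opA N j) = 1 := by
  rw [Matrix.conjTranspose_mul, opA_conjTranspose hj, opB_conjTranspose hi]
  calc opA N j * -opB N i * (opB N i * opA N j)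
      = -(opA N j * (opB N i * opB N i) * opA N j) := by noncomm_ring
    _ = 1 := by rw [opB_mul_self hi]; simp [opA_mul_self hj]

end Reality

end ClusterIsing

namespace ClusterIsing

open Matrix

variable {N : ℕ}

/-! ### Vector states as trial states -/

section VectorStates

/-- The vector state `X ↦ ⟨ψ, X ψ⟩ / ⟨ψ, ψ⟩`. -/
noncomputable def vecState (ψ : (Fin N → Fin 2) → ℂ) : Op N →ₗ[ℂ] ℂ where
  toFun X := (star ψ ⬝ᵥ X *ᵥ ψ) / (star ψ ⬝ᵥ ψ)
  map_add' X Y := by rw [Matrix.add_mulVec, dotProduct_add, add_div]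
  map_smul' c X := by
    rw [Matrix.smul_mulVec, dotProduct_smul, smul_eq_mul, mul_div_assoc, RingHom.id_apply,
      smul_eq_mul]

theorem vecState_apply (ψ : (Fin N → Fin 2) → ℂ) (X : Op N) :
    vecState ψ X = (star ψ ⬝ᵥ X *ᵥ ψ) / (star ψ ⬝ᵥ ψ) := rfl

theorem star_dotProduct_self_eq (ψ : (Fin N → Fin 2) → ℂ) :
    star ψ ⬝ᵥ ψ = ((∑ s, ‖ψ s‖ ^ 2 : ℝ) : ℂ) := by
  simp only [dotProduct, Pi.star_apply, Complex.star_def]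
  push_cast
  refine Finset.sum_congr rfl fun s _ => ?_
  rw [mul_comm, Complex.mul_conj, Complex.normSq_eq_norm_sq]
  push_cast
  rfl

theorem sum_norm_sq_pos {ψ : (Fin N → Fin 2) → ℂ} (hψ : ψ ≠ 0) : 0 < ∑ s, ‖ψ s‖ ^ 2 := by
  obtain ⟨s, hs⟩ := Function.ne_iff.1 hψ
  refine Finset.sum_pos' (fun _ _ => by positivity) ⟨s, Finset.mem_univ _, ?_⟩
  have : 0 < ‖ψ s‖ := norm_pos_iff.2 hs
  positivity

theorem isState_vecState {ψ : (Fin N → Fin 2) → ℂ} (hψ : ψ ≠ 0) : IsState (vecState ψ) := by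
  have hpos := sum_norm_sq_pos hψ
  refine ⟨?_, ?_, ?_⟩
  · rw [vecState_apply, Matrix.one_mulVec]
    refine div_self ?_
    rw [star_dotProduct_self_eq]
    exact_mod_cast hpos.ne'
  · intro X
    rw [vecState_apply, vecState_apply, map_div₀, star_dotProduct_self_eq, Complex.conj_ofReal]
    congr 1
    rw [← Complex.star_def, ← Matrix.star_dotProduct, Matrix.star_mulVec, Matrix.dotProduct_mulVec]
  · intro X
    have h : star ψ ⬝ᵥ (Xᴴ * X) *ᵥ ψ = star (X *ᵥ ψ) ⬝ᵥ (X *ᵥ ψ) := by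
      rw [Matrix.star_mulVec, ← Matrix.mulVec_mulVec, Matrix.dotProduct_mulVec]
    rw [vecState_apply, h, star_dotProduct_self_eq, star_dotProduct_self_eq, ← Complex.ofReal_div,
      Complex.ofReal_re]
    positivity

theorem groundEnergy_le_vecState {n : ℕ} {J φ : ℝ} (hN : n + 2 ≤ N) {ψ : (Fin N → Fin 2) → ℂ}
    (hψ : ψ ≠ 0) : groundEnergy N n J φ ≤ (vecState ψ (hamiltonian N n J φ)).re := by
  have h := groundEnergy_le (J := J) (φ := φ) hN ψ
  rw [star_dotProduct_self_eq, Complex.ofReal_re] at h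
  rw [vecState_apply, star_dotProduct_self_eq, Complex.div_ofReal_re, le_div_iff₀ (sum_norm_sq_pos hψ)]
  exact h

theorem vecState_mul_of_mulVec {ψ : (Fin N → Fin 2) → ℂ} {D : Op N} (hD : D *ᵥ ψ = -ψ) (X : Op N) :
    vecState ψ (X * D) = -vecState ψ X := by
  rw [vecState_apply, vecState_apply, ← Matrix.mulVec_mulVec, hD, Matrix.mulVec_neg, dotProduct_neg,
    neg_div]

theorem vecState_mul_of_mulVec' {ψ : (Fin N → Fin 2) → ℂ} {D : Op N} (hD : D *ᵥ ψ = -ψ)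
    (hD' : Dᴴ = D) (X : Op N) : vecState ψ (D * X) = -vecState ψ X := by
  have h : star ψ ᵥ* D = -star ψ := by
    have := congrArg star hD
    rwa [Matrix.star_mulVec, hD', star_neg] at this
  rw [vecState_apply, vecState_apply, ← Matrix.mulVec_mulVec, Matrix.dotProduct_mulVec, h,
    neg_dotProduct, neg_div]

end VectorStates

/-! ### Trial states with prescribed orthogonal correlation matrix -/

section QuasiFree

/-- A real orthogonal rotation of the operators `B_j`. -/
noncomputable def rotB (N : ℕ) (O : ℕ → ℕ → ℂ) (k : ℕ) : Op N :=
  ∑ j ∈ Finset.range N, O k j • opB N j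

variable {O : ℕ → ℕ → ℂ}

theorem rotB_conjTranspose (hO : ∀ i j, (starRingEnd ℂ) (O i j) = O i j) (k : ℕ) :
    (rotB N O k)ᴴ = -rotB N O k := by
  rw [rotB, Matrix.conjTranspose_sum, ← Finset.sum_neg_distrib]
  refine Finset.sum_congr rfl fun j hj => ?_
  rw [Matrix.conjTranspose_smul, opB_conjTranspose (Finset.mem_range.1 hj), Complex.star_def, hO,
    smul_neg]

theorem rotB_anticomm_opA (k : ℕ) {j : ℕ} (hj : j < N) :
    rotB N O k * opA N j = -(opA N j * rotB N O k) := by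
  rw [rotB, Finset.sum_mul, Finset.mul_sum, ← Finset.sum_neg_distrib]
  refine Finset.sum_congr rfl fun i hi => ?_
  rw [Matrix.smul_mul, Matrix.mul_smul, opB_anticomm_opA (Finset.mem_range.1 hi) hj, smul_neg]

theorem rotB_mul_add (k l : ℕ) : rotB N O k * rotB N O l + rotB N O l * rotB N O k =
    (-2 * ∑ j ∈ Finset.range N, O k j * O l j) • (1 : Op N) := by
  have h1 : rotB N O l * rotB N O k = ∑ i ∈ Finset.range N, ∑ j ∈ Finset.range N,
      (O k i * O l j) • (opB N j * opB N i) := by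
    rw [rotB, rotB, Finset.sum_mul_sum, Finset.sum_comm]
    refine Finset.sum_congr rfl fun i _ => Finset.sum_congr rfl fun j _ => ?_
    rw [Matrix.smul_mul, Matrix.mul_smul, smul_smul, mul_comm]
  have h2 : rotB N O k * rotB N O l = ∑ i ∈ Finset.range N, ∑ j ∈ Finset.range N,
      (O k i * O l j) • (opB N i * opB N j) := by
    rw [rotB, rotB, Finset.sum_mul_sum]
    refine Finset.sum_congr rfl fun i _ => Finset.sum_congr rfl fun j _ => ?_
    rw [Matrix.smul_mul, Matrix.mul_smul, smul_smul]
  rw [h1, h2, ← Finset.sum_add_distrib, Finset.mul_sum, Finset.sum_smul]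
  refine Finset.sum_congr rfl fun i hi => ?_
  rw [← Finset.sum_add_distrib, Finset.sum_eq_single i]
  · rw [opB_mul_self (Finset.mem_range.1 hi)]
    module
  · intro j hj hji
    rw [opB_anticomm_opB (Finset.mem_range.1 hj) (Finset.mem_range.1 hi) hji, smul_neg,
      add_neg_cancel]
  · exact fun h => (h hi).elim

/-- Commuting involutions $d_j$, each flipped by an $a_j$ that commutes with all the others, have a
common $-1$ eigenvector. Induct on their number: if $d_m\psi=\psi$, flip with $a_m$; otherwise
$\psi-d_m\psi$ is a nonzero vector with eigenvalue $-1$. -/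
theorem exists_vacuum {R : Type*} [Ring R] [Algebra ℂ R] {V : Type*} [AddCommGroup V] [Module R V]
    [Nontrivial V] {a d : ℕ → R} {N : ℕ}
    (hd : ∀ j < N, d j * d j = 1) (ha : ∀ j < N, a j * a j = 1)
    (had : ∀ j < N, d j * a j = -(a j * d j))
    (hc : ∀ j < N, ∀ k < N, j ≠ k → d j * a k = a k * d j)
    (hdd : ∀ j < N, ∀ k < N, j ≠ k → d j * d k = d k * d j) :
    ∀ m ≤ N, ∃ ψ : V, ψ ≠ 0 ∧ ∀ j < m, d j • ψ = -ψ := by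
  intro m
  induction m with
  | zero => exact fun _ => (exists_ne 0).imp fun ψ h => ⟨h, fun j hj => absurd hj (Nat.not_lt_zero j)⟩
  | succ m ih =>
    intro hm
    obtain ⟨ψ, hψ, h⟩ := ih (by omega)
    by_cases h0 : d m • ψ = ψ
    · refine ⟨a m • ψ, fun h1 => hψ ?_, fun j hj => ?_⟩
      · rw [← one_smul R ψ, ← ha m (by omega), mul_smul, h1, smul_zero]
      · rcases Nat.lt_succ_iff_lt_or_eq.1 hj with hj' | rfl
        · rw [← mul_smul, hc j (by omega) m (by omega) hj'.ne, mul_smul, h j hj', smul_neg]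
        · rw [← mul_smul, had j (by omega), neg_smul, mul_smul, h0]
    · refine ⟨ψ - d m • ψ, fun h1 => h0 (sub_eq_zero.1 h1).symm, fun j hj => ?_⟩
      rcases Nat.lt_succ_iff_lt_or_eq.1 hj with hj' | rfl
      · rw [smul_sub, ← mul_smul, hdd j (by omega) m (by omega) hj'.ne, mul_smul, h j hj', smul_neg]
        abel
      · rw [smul_sub, ← mul_smul, hd j (by omega), one_smul]
        abel

/-- For every real orthogonal matrix `O` there is a vector state with `⟨B_i A_j⟩ = O_{ji}`. -/
theorem exists_vecState_of_orthogonal (hreal : ∀ i j, (starRingEnd ℂ) (O i j) = O i j)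
    (hrow : ∀ k < N, ∀ l < N, ∑ j ∈ Finset.range N, O k j * O l j = if k = l then 1 else 0)
    (hcol : ∀ k < N, ∀ l < N, ∑ j ∈ Finset.range N, O j k * O j l = if k = l then 1 else 0) :
    ∃ ψ : (Fin N → Fin 2) → ℂ, ψ ≠ 0 ∧
      ∀ i < N, ∀ j < N, vecState ψ (opB N i * opA N j) = O j i := by
  -- Orthonormal rows make the rotated $B'_k$ satisfy the same Clifford relations as the $B_k$. The
  -- trial state is the common $-1$ eigenvector of the involutions $A_kB'_k$.
  have hBB : ∀ k < N, rotB N O k * rotB N O k = -1 := fun k hk => by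
    have h := rotB_mul_add (N := N) (O := O) k k
    rw [hrow k hk k hk, if_pos rfl, ← two_smul ℂ, mul_one, neg_smul, ← smul_neg] at h
    exact smul_right_injective _ (two_ne_zero' ℂ) h
  have hBB' : ∀ k < N, ∀ l < N, k ≠ l → rotB N O k * rotB N O l = -(rotB N O l * rotB N O k) :=
    fun k hk l hl hkl => by
      have h := rotB_mul_add (N := N) (O := O) k l
      rw [hrow k hk l hl, if_neg hkl, mul_zero, zero_smul] at h
      exact eq_neg_of_add_eq_zero_left h
  have hBA := fun k j (hj : j < N) => rotB_anticomm_opA (N := N) (O := O) k hj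
  have hDA : ∀ j < N, ∀ k < N, j ≠ k →
      opA N j * rotB N O j * opA N k = opA N k * (opA N j * rotB N O j) :=
    fun j hj k hk hjk => by
      rw [mul_assoc, hBA j k hk, mul_neg, ← mul_assoc, opA_anticomm_opA hj hk hjk, neg_mul, neg_neg,
        mul_assoc]
  have hDB : ∀ j < N, ∀ k < N, j ≠ k →
      opA N j * rotB N O j * rotB N O k = rotB N O k * (opA N j * rotB N O j) :=
    fun j hj k hk hjk => by
      rw [mul_assoc, hBB' j hj k hk hjk, mul_neg, ← mul_assoc, ← mul_assoc, hBA k j hj, neg_mul]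
  have hDDself : ∀ j < N, opA N j * rotB N O j * (opA N j * rotB N O j) = 1 := fun j hj => by
    rw [mul_assoc, ← mul_assoc (rotB N O j), hBA j j hj, neg_mul, mul_assoc (opA N j), hBB j hj,
      mul_neg, mul_neg, mul_neg, mul_one, neg_neg, opA_mul_self hj]
  have hDAself : ∀ j < N, opA N j * rotB N O j * opA N j = -(opA N j * (opA N j * rotB N O j)) :=
    fun j hj => by rw [mul_assoc, hBA j j hj, mul_neg]
  let _ : Module (Op N) ((Fin N → Fin 2) → ℂ) := Module.compHom _
    (Matrix.toLinAlgEquiv' : Op N ≃ₐ[ℂ] _).toRingEquiv.toRingHom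
  have hsmul : ∀ (X : Op N) (ψ : (Fin N → Fin 2) → ℂ), X • ψ = X *ᵥ ψ := fun X ψ => rfl
  obtain ⟨ψ, hψ, h⟩ := exists_vacuum (V := (Fin N → Fin 2) → ℂ) (a := opA N)
    (d := fun j => opA N j * rotB N O j) (N := N) hDDself (fun j hj => opA_mul_self hj) hDAself hDA
    (fun j hj k hk hjk => by
      rw [← mul_assoc, hDA j hj k hk hjk, mul_assoc, hDB j hj k hk hjk, mul_assoc]) N le_rfl
  simp only [hsmul] at h
  have hω := isState_vecState hψ
  have hDh : ∀ k < N, (opA N k * rotB N O k)ᴴ = opA N k * rotB N O k := fun k hk => by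
    rw [Matrix.conjTranspose_mul, rotB_conjTranspose hreal, opA_conjTranspose hk, neg_mul,
      hBA k k hk, neg_neg]
  have key : ∀ k < N, ∀ j < N, vecState ψ (rotB N O k * opA N j) = if k = j then 1 else 0 := by
    intro k hk j hj
    split_ifs with hkj
    · subst hkj
      have h1 := vecState_mul_of_mulVec (h k hk) 1
      rw [one_mul, hω.map_one] at h1
      rw [hBA k k hk, map_neg, h1, neg_neg]
    · have h1 := vecState_mul_of_mulVec (h k hk) (rotB N O k * opA N j)
      have h2 := vecState_mul_of_mulVec' (h k hk) (hDh k hk) (rotB N O k * opA N j)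
      -- The involution $A_kB'_k$ anticommutes with $B'_kA_j$ for $j\ne k$ but acts as $-1$ from
      -- either side in the state, so the expectation vanishes.
      have h3 : opA N k * rotB N O k * (rotB N O k * opA N j) =
          -(rotB N O k * opA N j * (opA N k * rotB N O k)) := by
        rw [mul_assoc (rotB N O k), ← hDA k hk j hj hkj, ← mul_assoc, ← mul_assoc, ← mul_assoc,
          hBA k k hk]
        noncomm_ring
      rw [h3, map_neg, h1] at h2
      linear_combination (1 / 2 : ℂ) * h2
  refine ⟨ψ, hψ, fun i hi j hj => ?_⟩
  -- Orthonormality of the columns inverts the rotation.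
  have h1 : opB N i = ∑ k ∈ Finset.range N, O k i • rotB N O k := by
    simp only [rotB, Finset.smul_sum, smul_smul]
    rw [Finset.sum_comm]
    simp only [← Finset.sum_smul]
    rw [Finset.sum_eq_single i]
    · rw [hcol i hi i hi, if_pos rfl, one_smul]
    · intro b hb hbi
      rw [hcol i hi b (Finset.mem_range.1 hb), if_neg hbi.symm, zero_smul]
    · exact fun h => (h (Finset.mem_range.2 hi)).elim
  rw [h1, Finset.sum_mul, map_sum, Finset.sum_eq_single j]
  · rw [Matrix.smul_mul, map_smul, key j hj j hj, if_pos rfl, smul_eq_mul, mul_one]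
  · intro b hb hbj
    rw [Matrix.smul_mul, map_smul, key b (Finset.mem_range.1 hb) j hj, if_neg hbj, smul_zero]
  · exact fun h => (h (Finset.mem_range.2 hj)).elim

end QuasiFree

/-! ### Orthogonal circulant matrices from the discrete Fourier transform -/

section Circulant

theorem sum_range_natCast_zmod [NeZero N] {M : Type*} [AddCommMonoid M] (f : ZMod N → M) :
    ∑ j ∈ Finset.range N, f (j : ZMod N) = ∑ x : ZMod N, f x :=
  Finset.sum_nbij' (fun j => (j : ZMod N)) ZMod.val (by simp)
    (fun x _ => Finset.mem_range.2 (ZMod.val_lt x))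
    (fun j hj => ZMod.val_cast_of_lt (Finset.mem_range.1 hj)) (fun x _ => ZMod.natCast_zmod_val x)
    (fun _ _ => rfl)

/-- The inverse discrete Fourier transform of `v`. -/
noncomputable def invDFT [NeZero N] (v : ZMod N → ℂ) (x : ZMod N) : ℂ :=
  (1 / N : ℂ) * ∑ p, v p * ZMod.stdAddChar (p * x)

theorem natCast_sub_eq_zero_iff {k l : ℕ} (hk : k < N) (hl : l < N) :
    ((k : ZMod N) - l = 0) ↔ k = l := by
  rw [sub_eq_zero, ZMod.natCast_eq_natCast_iff']
  rw [Nat.mod_eq_of_lt hk, Nat.mod_eq_of_lt hl]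

variable [NeZero N] {v : ZMod N → ℂ}

theorem sum_stdAddChar_mul (b : ZMod N) :
    ∑ p : ZMod N, (ZMod.stdAddChar (p * b) : ℂ) = if b = 0 then (N : ℂ) else 0 := by
  rw [AddChar.sum_mulShift b (ZMod.isPrimitive_stdAddChar N), ZMod.card]
  split_ifs <;> simp

theorem conj_stdAddChar (x : ZMod N) :
    (starRingEnd ℂ) (ZMod.stdAddChar x : ℂ) = ZMod.stdAddChar (-x) :=
  (AddChar.map_neg_eq_conj _ x).symm

theorem invDFT_real (hv : ∀ p, (starRingEnd ℂ) (v p) = v (-p)) (x : ZMod N) :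
    (starRingEnd ℂ) (invDFT v x) = invDFT v x := by
  rw [invDFT, map_mul, map_sum, map_div₀, map_one, Complex.conj_natCast]
  congr 1
  refine Fintype.sum_equiv (Equiv.neg _) _ _ fun p => ?_
  rw [map_mul, hv, conj_stdAddChar, Equiv.neg_apply, neg_mul]

/-- Summing over $x$ forces opposite momenta, and $v(p)v(-p)=1$ leaves the inverse transform of the
constant 1. This is the orthogonality of the circulant matrix built from `invDFT v`. -/
theorem sum_invDFT_mul (hv : ∀ p, v p * v (-p) = 1) (c : ZMod N) :
    ∑ x, invDFT v x * invDFT v (x + c) = if c = 0 then 1 else 0 := by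
  have hN : (N : ℂ) ≠ 0 := Nat.cast_ne_zero.2 (NeZero.ne N)
  have h : ∀ x, invDFT v x * invDFT v (x + c) = (1 / N : ℂ) * (1 / N) *
      ∑ p, ∑ q, v p * v q * ZMod.stdAddChar (q * c) * ZMod.stdAddChar (x * (p + q)) := fun x => by
    rw [invDFT, invDFT, mul_mul_mul_comm, Finset.sum_mul_sum]
    congr 1
    refine Finset.sum_congr rfl fun p _ => Finset.sum_congr rfl fun q _ => ?_
    have : (ZMod.stdAddChar (p * x) : ℂ) * ZMod.stdAddChar (q * (x + c)) =
        ZMod.stdAddChar (q * c) * ZMod.stdAddChar (x * (p + q)) := by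
      rw [← AddChar.map_add_eq_mul, ← AddChar.map_add_eq_mul]
      congr 1; ring
    linear_combination (v p * v q) * this
  simp only [h]
  rw [← Finset.mul_sum, Finset.sum_comm]
  have h2 : ∀ p, ∑ x : ZMod N, ∑ q, v p * v q * ZMod.stdAddChar (q * c) *
      (ZMod.stdAddChar (x * (p + q)) : ℂ) = N * ZMod.stdAddChar (-p * c) := fun p => by
    rw [Finset.sum_comm]
    simp only [← Finset.mul_sum, sum_stdAddChar_mul]
    rw [Finset.sum_eq_single (-p)]
    · rw [hv, add_neg_cancel, if_pos rfl, one_mul, mul_comm]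
    · intro q _ hq
      rw [if_neg (fun h0 => hq (eq_neg_of_add_eq_zero_right h0)), mul_zero]
    · exact fun h => (h (Finset.mem_univ _)).elim
  simp only [h2]
  rw [← Finset.mul_sum]
  have h3 : ∑ p : ZMod N, (ZMod.stdAddChar (-p * c) : ℂ) = if c = 0 then (N : ℂ) else 0 := by
    rw [← sum_stdAddChar_mul]
    exact Fintype.sum_equiv (Equiv.neg _) _ _ fun p => rfl
  rw [h3]
  split_ifs
  · field_simp
  · simp

theorem exists_vecState_invDFT (hv : ∀ p, (starRingEnd ℂ) (v p) = v (-p)) (hv1 : ∀ p, ‖v p‖ = 1) :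
    ∃ ψ : (Fin N → Fin 2) → ℂ, ψ ≠ 0 ∧
      ∀ i < N, ∀ j < N, vecState ψ (opB N i * opA N j) = invDFT v ((j : ZMod N) - i) := by
  have hvv : ∀ p, v p * v (-p) = 1 := fun p => by
    rw [← hv, Complex.mul_conj, Complex.normSq_eq_norm_sq, hv1]; simp
  refine exists_vecState_of_orthogonal (O := fun i j => invDFT v ((i : ZMod N) - j))
    (fun i j => invDFT_real hv _) (fun k hk l hl => ?_) (fun k hk l hl => ?_)
  · rw [sum_range_natCast_zmod (fun j : ZMod N => invDFT v ((k : ZMod N) - j) *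
      invDFT v ((l : ZMod N) - j))]
    rw [Fintype.sum_equiv (Equiv.subLeft (k : ZMod N)) _
      (fun x => invDFT v x * invDFT v (x + ((l : ZMod N) - k))), sum_invDFT_mul hvv]
    · simp only [natCast_sub_eq_zero_iff hl hk, eq_comm]
    · intro x
      rw [Equiv.subLeft_apply]
      congr 2; ring
  · rw [sum_range_natCast_zmod (fun j : ZMod N => invDFT v (j - (k : ZMod N)) *
      invDFT v (j - (l : ZMod N)))]
    rw [Fintype.sum_equiv (Equiv.subRight (k : ZMod N)) _
      (fun x => invDFT v x * invDFT v (x + ((k : ZMod N) - l))), sum_invDFT_mul hvv]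
    · simp only [natCast_sub_eq_zero_iff hk hl]
    · intro x
      rw [Equiv.subRight_apply]
      congr 2; ring

end Circulant

end ClusterIsing

namespace ClusterIsing

open MeasureTheory

/-! ### Exponential phases and their orthogonality -/

section Phase

/-- The phase `exp (i x)`. -/
noncomputable def phase (x : ℝ) : ℂ := Complex.exp (x * Complex.I)

theorem phase_add (x y : ℝ) : phase (x + y) = phase x * phase y := by
  rw [phase, phase, phase, ← Complex.exp_add]; push_cast; ring_nf

theorem phase_zero : phase 0 = 1 := by simp [phase]

theorem norm_phase (x : ℝ) : ‖phase x‖ = 1 := Complex.norm_exp_ofReal_mul_I x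

theorem conj_phase (x : ℝ) : (starRingEnd ℂ) (phase x) = phase (-x) := by
  rw [phase, phase, ← Complex.exp_conj]; simp

theorem re_phase (x : ℝ) : (phase x).re = Real.cos x := Complex.exp_ofReal_mul_I_re x

theorem continuous_phase : Continuous phase := by unfold phase; fun_prop

theorem phase_eq_one_iff (x : ℝ) : phase x = 1 ↔ ∃ l : ℤ, x = l * (2 * Real.pi) := by
  rw [phase, Complex.exp_eq_one_iff]
  refine exists_congr fun l => ⟨fun h => ?_, fun h => ?_⟩
  · have h' : (x : ℂ) = ((l * (2 * Real.pi) : ℝ) : ℂ) := by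
      apply mul_right_cancel₀ Complex.I_ne_zero
      rw [h]; push_cast; ring
    exact_mod_cast h'
  · rw [h]; push_cast; ring

theorem phase_int_mul_two_pi (l : ℤ) : phase (l * (2 * Real.pi)) = 1 :=
  (phase_eq_one_iff _).2 ⟨l, rfl⟩

theorem integral_phase (m : ℤ) :
    ∫ k in (0 : ℝ)..2 * Real.pi, phase (m * k) = if m = 0 then ((2 * Real.pi : ℝ) : ℂ) else 0 := by
  split_ifs with h
  · subst h
    simp [phase_zero]
  · have hm : (m : ℂ) * Complex.I ≠ 0 := mul_ne_zero (Int.cast_ne_zero.2 h) Complex.I_ne_zero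
    have h1 : ∀ k : ℝ, phase (m * k) = Complex.exp ((m : ℂ) * Complex.I * k) := fun k => by
      rw [phase]; push_cast; ring_nf
    have h2 := phase_int_mul_two_pi m
    rw [h1] at h2
    simp only [h1]
    rw [integral_exp_mul_complex hm, h2]
    simp

end Phase

/-! ### The symbol of the quadratic Hamiltonian -/

section Symbol

/-- The symbol of the quadratic fermionic Hamiltonian. -/
noncomputable def symbol (n : ℕ) (φ : ℝ) (k : ℝ) : ℂ :=
  Real.cos φ * phase (((n : ℝ) + 1) * k) - Real.sin φ * phase (-k)

/-- The conjugate of the symbol, normalized to modulus one. -/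
noncomputable def unitSymbol (n : ℕ) (φ : ℝ) (k : ℝ) : ℂ :=
  (starRingEnd ℂ) (symbol n φ k) / ‖symbol n φ k‖

variable {n : ℕ} {φ : ℝ}

theorem continuous_symbol : Continuous (symbol n φ) := by
  unfold symbol
  have := continuous_phase
  fun_prop

/-- The frequencies $n+1$ and $-1$ agree modulo $n+2$, so both terms acquire the same phase. The
zeros of $G_r$ come from this. -/
theorem symbol_add (k δ : ℝ) (h : phase (((n : ℝ) + 2) * δ) = 1) :
    symbol n φ (k + δ) = phase (-δ) * symbol n φ k := by
  have h1 : phase (((n : ℝ) + 1) * (k + δ)) = phase (-δ) * phase (((n : ℝ) + 1) * k) := by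
    rw [← mul_one (phase (-δ) * _), ← h, ← phase_add, ← phase_add]; congr 1; ring
  have h2 : phase (-(k + δ)) = phase (-δ) * phase (-k) := by
    rw [← phase_add]; congr 1; ring
  rw [symbol, symbol, h1, h2]; ring

theorem unitSymbol_add (k δ : ℝ) (h : phase (((n : ℝ) + 2) * δ) = 1) :
    unitSymbol n φ (k + δ) = phase δ * unitSymbol n φ k := by
  rw [unitSymbol, unitSymbol, symbol_add k δ h, map_mul, conj_phase, neg_neg, norm_mul, norm_phase,
    one_mul, mul_div_assoc]

theorem symbol_neg (k : ℝ) : symbol n φ (-k) = (starRingEnd ℂ) (symbol n φ k) := by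
  rw [symbol, symbol, map_sub, map_mul, map_mul, conj_phase, conj_phase, Complex.conj_ofReal,
    Complex.conj_ofReal, mul_neg]

theorem unitSymbol_neg (k : ℝ) : unitSymbol n φ (-k) = (starRingEnd ℂ) (unitSymbol n φ k) := by
  rw [unitSymbol, unitSymbol, symbol_neg, map_div₀, Complex.conj_ofReal, Complex.norm_conj]

theorem norm_symbol_sq (k : ℝ) :
    ‖symbol n φ k‖ ^ 2 = 1 - Real.cos (((n : ℝ) + 2) * k) * Real.sin (2 * φ) := by
  have h : symbol n φ k * (starRingEnd ℂ) (symbol n φ k) =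
      (Real.cos φ ^ 2 + Real.sin φ ^ 2 : ℝ) - (Real.cos φ * Real.sin φ : ℝ) *
        (phase (((n : ℝ) + 2) * k) + (starRingEnd ℂ) (phase (((n : ℝ) + 2) * k))) := by
    have h1 : phase (((n : ℝ) + 1) * k) * phase (-(((n : ℝ) + 1) * k)) = 1 := by
      rw [← phase_add, add_neg_cancel, phase_zero]
    have h2 : phase (-k) * phase k = 1 := by rw [← phase_add, neg_add_cancel, phase_zero]
    have h3 : phase (((n : ℝ) + 1) * k) * phase k = phase (((n : ℝ) + 2) * k) := by
      rw [← phase_add]; congr 1; ring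
    have h4 : phase (-(((n : ℝ) + 1) * k)) * phase (-k) = phase (-(((n : ℝ) + 2) * k)) := by
      rw [← phase_add]; congr 1; ring
    rw [symbol, map_sub, map_mul, map_mul, conj_phase, conj_phase, Complex.conj_ofReal,
      Complex.conj_ofReal, neg_neg, conj_phase, ← h3, ← h4]
    push_cast
    linear_combination (Complex.cos φ) ^ 2 * h1 + (Complex.sin φ) ^ 2 * h2
  rw [Complex.mul_conj, Complex.normSq_eq_norm_sq, Complex.add_conj, re_phase,
    ← Complex.ofReal_mul, ← Complex.ofReal_sub, Complex.ofReal_inj] at h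
  rw [h, Real.sin_two_mul, Real.cos_sq_add_sin_sq]
  ring

theorem norm_symbol (k : ℝ) : ‖symbol n φ k‖ =
    Real.sqrt (1 - Real.cos (((n : ℝ) + 2) * k) * Real.sin (2 * φ)) := by
  rw [← norm_symbol_sq, Real.sqrt_sq (norm_nonneg _)]

theorem norm_symbol_le (k : ℝ) : ‖symbol n φ k‖ ≤ 2 := by
  refine (norm_sub_le _ _).trans ?_
  rw [norm_mul, norm_mul, norm_phase, norm_phase, mul_one, mul_one, Complex.norm_real,
    Complex.norm_real, Real.norm_eq_abs, Real.norm_eq_abs]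
  linarith [Real.abs_cos_le_one φ, Real.abs_sin_le_one φ]

/-- A zero needs $\cos((n+2)k)\sin2\phi=1$, hence $\sin((n+2)k)=0$. Such zeros do occur at critical
$\phi$; having only countably many lets one argument cover all $\phi$. -/
theorem countable_setOf_symbol_eq_zero : {k : ℝ | symbol n φ k = 0}.Countable := by
  refine (Set.countable_range fun m : ℤ => m * Real.pi / ((n : ℝ) + 2)).mono fun k hk => ?_
  have h := norm_symbol_sq (n := n) (φ := φ) k
  rw [show symbol n φ k = 0 from hk, norm_zero] at h
  have h1 : Real.sin (((n : ℝ) + 2) * k) = 0 := by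
    have h2 := Real.sin_sq_add_cos_sq (((n : ℝ) + 2) * k)
    have h3 := Real.sin_sq_le_one (2 * φ)
    have h4 : (Real.cos (((n : ℝ) + 2) * k) * Real.sin (2 * φ)) ^ 2 = 1 := by
      rw [show Real.cos (((n : ℝ) + 2) * k) * Real.sin (2 * φ) = 1 by linarith]; norm_num
    rw [mul_pow] at h4
    have h5 : Real.sin (((n : ℝ) + 2) * k) ^ 2 ≤ 0 := by
      nlinarith [sq_nonneg (Real.cos (((n : ℝ) + 2) * k)), sq_nonneg (Real.sin (((n : ℝ) + 2) * k))]
    exact pow_eq_zero_iff two_ne_zero |>.1 (le_antisymm h5 (sq_nonneg _))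
  obtain ⟨m, hm⟩ := Real.sin_eq_zero_iff.1 h1
  refine ⟨m, ?_⟩
  simp only [hm]
  field_simp

theorem ae_symbol_ne_zero : ∀ᵐ k : ℝ, symbol n φ k ≠ 0 :=
  (countable_setOf_symbol_eq_zero (n := n) (φ := φ)).ae_notMem volume

theorem norm_unitSymbol_le (k : ℝ) : ‖unitSymbol n φ k‖ ≤ 1 := by
  rw [unitSymbol, norm_div, Complex.norm_conj, Complex.norm_real, norm_norm]
  exact div_self_le_one _

theorem norm_unitSymbol {k : ℝ} (h : symbol n φ k ≠ 0) : ‖unitSymbol n φ k‖ = 1 := by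
  rw [unitSymbol, norm_div, Complex.norm_conj, Complex.norm_real, norm_norm]
  exact div_self (norm_ne_zero_iff.2 h)

theorem measurable_unitSymbol : Measurable (unitSymbol n φ) := by
  unfold unitSymbol
  have := (continuous_symbol (n := n) (φ := φ)).measurable
  exact (Complex.continuous_conj.measurable.comp this).div
    (Complex.measurable_ofReal.comp this.norm)

theorem intervalIntegrable_of_norm_le {f : ℝ → ℂ} (hf : Measurable f) {C : ℝ} (h : ∀ k, ‖f k‖ ≤ C)
    (a b : ℝ) : IntervalIntegrable f volume a b := by
  rw [intervalIntegrable_iff]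
  exact Measure.integrableOn_of_bounded (by simp) hf.aestronglyMeasurable
    (Filter.Eventually.of_forall h)

theorem measurable_unitSymbol_mul_phase (r : ℝ) :
    Measurable fun k => unitSymbol n φ k * phase (-(r * k)) := by
  have := continuous_phase.measurable
  exact measurable_unitSymbol.mul (by fun_prop)

theorem norm_unitSymbol_mul_phase_le (r k : ℝ) : ‖unitSymbol n φ k * phase (-(r * k))‖ ≤ 1 := by
  rw [norm_mul, norm_phase, mul_one]; exact norm_unitSymbol_le k

end Symbol

/-! ### G as Fourier coefficients: vanishing and Parseval -/

section FourierCoefficients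

variable {n : ℕ} {φ : ℝ}

/-- The reflection $k\mapsto2\pi-k$ conjugates the integrand, so the integral over the full period
is twice the real part over $[0,\pi]$. -/
theorem G_eq_integral (r : ℤ) : ((G n φ r : ℝ) : ℂ) =
    (1 / (2 * Real.pi) : ℂ) *
      ∫ k in (0 : ℝ)..2 * Real.pi, unitSymbol n φ k * phase (-(r * k)) := by
  set F : ℝ → ℂ := fun k => unitSymbol n φ k * phase (-(r * k)) with hF
  have hint : ∀ a b, IntervalIntegrable F volume a b :=
    intervalIntegrable_of_norm_le (measurable_unitSymbol_mul_phase r)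
      (norm_unitSymbol_mul_phase_le (r : ℝ))
  have hper : ∀ k, F (k + 2 * Real.pi) = F k := fun k => by
    have h1 := phase_int_mul_two_pi ((n : ℤ) + 2)
    have h2 := phase_int_mul_two_pi (-r)
    have h3 := phase_int_mul_two_pi 1
    push_cast at h1 h2 h3
    rw [one_mul] at h3
    simp only [hF]
    rw [unitSymbol_add k _ h1, h3, one_mul, show -((r : ℝ) * (k + 2 * Real.pi)) =
      -(r * k) + -r * (2 * Real.pi) by ring, phase_add, h2, mul_one]
  have hneg : ∀ k, F (-k) = (starRingEnd ℂ) (F k) := fun k => by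
    simp only [hF]
    rw [unitSymbol_neg, map_mul, conj_phase]; congr 2; ring
  have h1 : ∫ k in Real.pi..2 * Real.pi, F k = ∫ k in (0 : ℝ)..Real.pi, (starRingEnd ℂ) (F k) := by
    have := intervalIntegral.integral_comp_sub_left (a := 0) (b := Real.pi) F (2 * Real.pi)
    rw [sub_zero, show 2 * Real.pi - Real.pi = Real.pi by ring] at this
    rw [← this]
    refine intervalIntegral.integral_congr fun k _ => ?_
    rw [show 2 * Real.pi - k = -k + 2 * Real.pi by ring, hper, hneg]
  have hconj : IntervalIntegrable (fun k => (starRingEnd ℂ) (F k)) volume 0 Real.pi :=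
    intervalIntegrable_of_norm_le
      (Complex.continuous_conj.measurable.comp (measurable_unitSymbol_mul_phase r))
      (fun k => (Complex.norm_conj _).trans_le (norm_unitSymbol_mul_phase_le (r : ℝ) k)) _ _
  rw [← intervalIntegral.integral_add_adjacent_intervals (hint 0 Real.pi) (hint _ _), h1,
    ← intervalIntegral.integral_add (hint _ _) hconj]
  have hre : ∀ k : ℝ, F k + (starRingEnd ℂ) (F k) = ((2 * ((Real.cos (k * ((n : ℝ) + 1 + (r : ℝ))) *
      Real.cos φ - Real.cos (k * ((r : ℝ) - 1)) * Real.sin φ)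
      / Real.sqrt (1 - Real.cos (((n : ℝ) + 2) * k) * Real.sin (2 * φ))) : ℝ) : ℂ) := fun k => by
    rw [Complex.add_conj]
    congr 2
    have h : F k = (Real.cos φ * phase (-(k * ((n : ℝ) + 1 + r))) -
        Real.sin φ * phase (-(k * ((r : ℝ) - 1)))) / ((‖symbol n φ k‖ : ℝ) : ℂ) := by
      simp only [hF, unitSymbol]
      rw [div_mul_eq_mul_div, symbol, map_sub, map_mul, map_mul, conj_phase, conj_phase,
        Complex.conj_ofReal, Complex.conj_ofReal, sub_mul, mul_assoc, mul_assoc, ← phase_add,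
        ← phase_add]
      congr 4 <;> ring_nf
    rw [h, Complex.div_ofReal_re, Complex.sub_re, Complex.re_ofReal_mul, Complex.re_ofReal_mul,
      re_phase, re_phase, Real.cos_neg, Real.cos_neg, norm_symbol]
    ring
  simp only [hre]
  rw [intervalIntegral.integral_ofReal, intervalIntegral.integral_const_mul, G]
  generalize intervalIntegral (E := ℝ) _ _ _ _ = I
  push_cast
  field_simp

/-- Translation by $\delta=2\pi/(n+2)$ preserves the integral over a period but multiplies the
integrand by $e^{i(1-r)\delta}$, which is 1 only if $n+2$ divides $r-1$. -/
theorem G_eq_zero (r : ℤ) (hr : ¬ ∃ l : ℤ, r = l * ((n : ℤ) + 2) + 1) : G n φ r = 0 := by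
  set F : ℝ → ℂ := fun k => unitSymbol n φ k * phase (-(r * k)) with hF
  have hn : (n : ℝ) + 2 ≠ 0 := by positivity
  set δ : ℝ := 2 * Real.pi / ((n : ℝ) + 2) with hδ
  have hper : Function.Periodic F (2 * Real.pi) := fun k => by
    have h1 := phase_int_mul_two_pi ((n : ℤ) + 2)
    have h2 := phase_int_mul_two_pi (-r)
    have h3 := phase_int_mul_two_pi 1
    push_cast at h1 h2 h3
    rw [one_mul] at h3
    simp only [hF]
    rw [unitSymbol_add k _ h1, h3, one_mul, show -((r : ℝ) * (k + 2 * Real.pi)) =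
      -(r * k) + -r * (2 * Real.pi) by ring, phase_add, h2, mul_one]
  have hshift : ∀ k, F (k + δ) = phase ((1 - r) * δ) * F k := fun k => by
    have h1 : phase (((n : ℝ) + 2) * δ) = 1 := by
      rw [phase_eq_one_iff]; exact ⟨1, by rw [hδ]; field_simp; simp⟩
    simp only [hF]
    rw [unitSymbol_add k δ h1, show -((r : ℝ) * (k + δ)) = -(r * k) + -r * δ by ring, phase_add,
      show (1 - (r : ℝ)) * δ = δ + -r * δ by ring, phase_add]
    ring
  have hI : ∫ k in (0 : ℝ)..2 * Real.pi, F k =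
      phase ((1 - r) * δ) * ∫ k in (0 : ℝ)..2 * Real.pi, F k := by
    rw [← intervalIntegral.integral_const_mul]
    simp only [← hshift]
    rw [intervalIntegral.integral_comp_add_right F δ, zero_add, add_comm (2 * Real.pi) δ]
    have := hper.intervalIntegral_add_eq 0 δ
    rwa [zero_add] at this
  have hne : phase ((1 - r) * δ) ≠ 1 := by
    rw [Ne, phase_eq_one_iff]
    rintro ⟨l, hl⟩
    refine hr ⟨-l, ?_⟩
    rw [hδ, mul_div_assoc', div_eq_iff hn] at hl
    have h2 : (1 - (r : ℝ)) = l * ((n : ℝ) + 2) :=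
      mul_right_cancel₀ Real.two_pi_pos.ne' (by linear_combination hl)
    have h3 : 1 - r = l * ((n : ℤ) + 2) := by exact_mod_cast h2
    linarith
  have h0 : ∫ k in (0 : ℝ)..2 * Real.pi, F k = 0 := by
    by_contra h
    exact hne (mul_right_cancel₀ h (by rw [one_mul]; exact hI.symm))
  have := G_eq_integral (n := n) (φ := φ) r
  rw [h0, mul_zero] at this
  exact_mod_cast this

/-- Parseval for a function of modulus one almost everywhere. The exact value 1 is what makes
$A_i+\sum_jG_{j-i}B_j$ annihilate the limiting state. -/
theorem hasSum_G_sq : HasSum (fun r : ℤ => G n φ r ^ 2) 1 := by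
  have hL2 : MemLp (unitSymbol n φ) 2 (volume.restrict (Set.Ioc 0 (2 * Real.pi))) :=
    MemLp.of_bound measurable_unitSymbol.aestronglyMeasurable 1
      (Filter.Eventually.of_forall norm_unitSymbol_le)
  have h := hasSum_sq_fourierCoeffOn Real.two_pi_pos hL2
  have h1 : ∫ k in (0 : ℝ)..2 * Real.pi, ‖unitSymbol n φ k‖ ^ 2 = 2 * Real.pi := by
    rw [intervalIntegral.integral_congr_ae (g := fun _ => (1 : ℝ))]
    · simp
    · filter_upwards [ae_symbol_ne_zero (n := n) (φ := φ)] with k hk _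
      rw [norm_unitSymbol hk, one_pow]
  rw [h1, sub_zero, smul_eq_mul, inv_mul_cancel₀ Real.two_pi_pos.ne'] at h
  convert h using 2 with r
  have h2 : fourierCoeffOn Real.two_pi_pos (unitSymbol n φ) r = (G n φ r : ℂ) := by
    rw [fourierCoeffOn_eq_integral, G_eq_integral, sub_zero]
    rw [Complex.real_smul]
    push_cast
    congr 1
    refine intervalIntegral.integral_congr fun k _ => ?_
    rw [fourier_coe_apply, smul_eq_mul, mul_comm]
    congr 1
    rw [phase]
    congr 1
    have : (Real.pi : ℂ) ≠ 0 := Complex.ofReal_ne_zero.2 Real.pi_ne_zero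
    push_cast
    field_simp
  rw [h2, Complex.norm_real, Real.norm_eq_abs, sq_abs]

end FourierCoefficients

/-! ### Stability of the energy minimizer in L¹ -/

section Minimizers

variable {n : ℕ} {φ : ℝ}

/-- With $u=\bar s/|s|$, expand $|f-u|^2=|f|^2+1-2\,\mathrm{Re}(fs)/|s|$ and use $|f|\le1$. The
energy defect thus controls the distance to the minimizer, weighted by $|s|$. -/
theorem norm_symbol_mul_sq_le {f : ℂ} (hf : ‖f‖ ≤ 1) (k : ℝ) :
    ‖symbol n φ k‖ * ‖f - unitSymbol n φ k‖ ^ 2 ≤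
      2 * (‖symbol n φ k‖ - (f * symbol n φ k).re) := by
  by_cases h : symbol n φ k = 0
  · simp [h]
  have hpos : 0 < ‖symbol n φ k‖ := norm_pos_iff.2 h
  have h1 : ‖f - unitSymbol n φ k‖ ^ 2 =
      ‖f‖ ^ 2 + 1 - 2 * ((f * symbol n φ k).re / ‖symbol n φ k‖) := by
    have h2 := norm_unitSymbol h
    rw [← Complex.normSq_eq_norm_sq, Complex.normSq_sub, Complex.normSq_eq_norm_sq,
      Complex.normSq_eq_norm_sq, h2, one_pow]
    congr 2
    rw [unitSymbol, map_div₀, Complex.conj_conj, Complex.conj_ofReal, mul_div_assoc',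
      Complex.div_ofReal_re]
  rw [h1]
  have h3 : ‖f‖ ^ 2 ≤ 1 := by nlinarith [norm_nonneg f]
  have h4 : ‖symbol n φ k‖ * ((f * symbol n φ k).re / ‖symbol n φ k‖) = (f * symbol n φ k).re :=
    mul_div_cancel₀ _ hpos.ne'
  nlinarith

/-- Removes the weight $|s|$, which has no positive lower bound in general. The first term covers
momenta where $|s|$ is at most of order $1/m$; elsewhere $|s||f-u|$ is bounded by the defect via
$|s|(|f-u|-2\varepsilon)^2\ge0$ and $|s|\le2$. -/
theorem norm_sub_unitSymbol_le {f : ℂ} (hf : ‖f‖ ≤ 1) (k : ℝ) {m ε : ℝ} (hm : 0 ≤ m) (hε : 0 < ε) :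
    ‖f - unitSymbol n φ k‖ ≤ 2 * (1 + m * ‖symbol n φ k‖)⁻¹ +
      (2 * m * ε + m / (2 * ε) * (‖symbol n φ k‖ - (f * symbol n φ k).re)) := by
  set a := ‖symbol n φ k‖ with ha
  set h := ‖f - unitSymbol n φ k‖ with hh
  set d := a - (f * symbol n φ k).re with hd
  have ha0 : 0 ≤ a := norm_nonneg _
  have ha2 : a ≤ 2 := norm_symbol_le k
  have hh0 : 0 ≤ h := norm_nonneg _
  have hh2 : h ≤ 2 := (norm_sub_le _ _).trans (by linarith [norm_unitSymbol_le (n := n) (φ := φ) k])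
  have h1 : a * h ^ 2 ≤ 2 * d := norm_symbol_mul_sq_le hf k
  have h2 : a * h ≤ 2 * ε + d / (2 * ε) := by
    rw [← sub_nonneg]
    have : 0 ≤ (2 * ε + d / (2 * ε) - a * h) * (4 * ε) := by
      have h3 : (2 * ε + d / (2 * ε) - a * h) * (4 * ε) = 8 * ε ^ 2 + 2 * d - 4 * ε * (a * h) := by
        field_simp
        ring
      rw [h3]
      nlinarith [mul_nonneg ha0 (sq_nonneg (h - 2 * ε)), sq_nonneg ε]
    exact nonneg_of_mul_nonneg_left this (by positivity)
  have hpos : 0 < 1 + m * a := by positivity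
  have h3 : h ≤ 2 * (1 + m * a)⁻¹ + m * (a * h) := by
    have h4 : h = h * (1 + m * a)⁻¹ + m * (a * h) * (1 + m * a)⁻¹ := by field_simp
    have h5 : (1 + m * a)⁻¹ ≤ 1 := inv_le_one_of_one_le₀ (by nlinarith [mul_nonneg hm ha0])
    have h6 : 0 ≤ (1 + m * a)⁻¹ := by positivity
    have h7 : m * (a * h) * (1 + m * a)⁻¹ ≤ m * (a * h) :=
      mul_le_of_le_one_right (by positivity) h5
    have h8 : h * (1 + m * a)⁻¹ ≤ 2 * (1 + m * a)⁻¹ := by gcongr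
    linarith
  calc h ≤ 2 * (1 + m * a)⁻¹ + m * (a * h) := h3
    _ ≤ 2 * (1 + m * a)⁻¹ + m * (2 * ε + d / (2 * ε)) := by gcongr
    _ = _ := by ring

theorem tendsto_integral_inv_symbol :
    Tendsto (fun m : ℕ => ∫ k in (0 : ℝ)..2 * Real.pi, (1 + (m : ℝ) * ‖symbol n φ k‖)⁻¹)
      atTop (𝓝 0) := by
  have h := intervalIntegral.tendsto_integral_filter_of_dominated_convergence
    (μ := volume) (a := 0) (b := 2 * Real.pi) (l := atTop)
    (F := fun (m : ℕ) k => (1 + (m : ℝ) * ‖symbol n φ k‖)⁻¹) (f := fun _ => (0 : ℝ))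
    (fun _ => (1 : ℝ)) ?_ ?_ intervalIntegrable_const ?_
  · simpa using h
  · refine Filter.Eventually.of_forall fun m => ?_
    have := (continuous_symbol (n := n) (φ := φ)).measurable
    exact (Measurable.inv (by fun_prop)).aestronglyMeasurable
  · refine Filter.Eventually.of_forall fun m => Filter.Eventually.of_forall fun k _ => ?_
    have h0 : 0 ≤ (m : ℝ) * ‖symbol n φ k‖ := by positivity
    rw [Real.norm_of_nonneg (by positivity)]
    exact inv_le_one_of_one_le₀ (by linarith)
  · filter_upwards [ae_symbol_ne_zero (n := n) (φ := φ)] with k hk _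
    have hpos : 0 < ‖symbol n φ k‖ := norm_pos_iff.2 hk
    exact tendsto_inv_atTop_zero.comp (tendsto_atTop_add_const_left _ _
      (tendsto_natCast_atTop_atTop.atTop_mul_const hpos))

/-- Almost minimizers of the energy among the functions bounded by one have almost the Fourier
coefficients of the minimizer. -/
theorem tendsto_integral_of_energy {f : ℕ → ℝ → ℂ} (hc : ∀ N, Continuous (f N))
    (hf : ∀ᶠ N in atTop, ∀ k, ‖f N k‖ ≤ 1)
    (hE : Tendsto (fun N => ∫ k in (0 : ℝ)..2 * Real.pi,
      (‖symbol n φ k‖ - (f N k * symbol n φ k).re)) atTop (𝓝 0)) (r : ℝ) :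
    Tendsto (fun N => ∫ k in (0 : ℝ)..2 * Real.pi, f N k * phase (-(r * k))) atTop
      (𝓝 (∫ k in (0 : ℝ)..2 * Real.pi, unitSymbol n φ k * phase (-(r * k)))) := by
  have hs := continuous_symbol (n := n) (φ := φ)
  have hph := continuous_phase
  have hpi := Real.two_pi_pos
  rw [Metric.tendsto_atTop]
  intro η hη
  obtain ⟨m, hm⟩ := ((tendsto_order.1 (tendsto_integral_inv_symbol (n := n) (φ := φ))).2 (η / 8)
    (by positivity)).exists
  -- The order of choices is $m$, then ε, then $N$. The three contributions are at most $2\eta/8$,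
  -- $\eta/8$ and $\eta/8$; writing $m+1$ keeps the denominator positive for $m=0$.
  set ε : ℝ := η / (8 * (2 * (m + 1) * (2 * Real.pi))) with hε
  have hε0 : 0 < ε := by positivity
  have hmε : 2 * (m : ℝ) * ε * (2 * Real.pi) ≤ η / 8 := by
    rw [hε, mul_assoc, mul_comm (_ / _), mul_div_assoc', mul_div_assoc', div_le_div_iff₀
      (by positivity) (by norm_num)]
    nlinarith [mul_pos hη hpi]
  have hE' := hE.const_mul ((m : ℝ) / (2 * ε))
  rw [mul_zero] at hE'
  have hev := (tendsto_order.1 hE').2 (η / 8) (by positivity)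
  obtain ⟨N₀, hN₀⟩ := eventually_atTop.1 (hev.and hf)
  refine ⟨N₀, fun N hN => ?_⟩
  obtain ⟨h1, h2⟩ := hN₀ N hN
  have hi1 : IntervalIntegrable (fun k => f N k * phase (-(r * k))) volume 0 (2 * Real.pi) := by
    have := hc N
    exact Continuous.intervalIntegrable (by fun_prop) _ _
  have hi2 := intervalIntegrable_of_norm_le (measurable_unitSymbol_mul_phase (n := n) (φ := φ) r)
    (norm_unitSymbol_mul_phase_le r) 0 (2 * Real.pi)
  have hi3 : IntervalIntegrable (fun k => 2 * (1 + (m : ℝ) * ‖symbol n φ k‖)⁻¹) volume 0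
      (2 * Real.pi) := by
    refine Continuous.intervalIntegrable (continuous_const.mul (Continuous.inv₀ (by fun_prop)
      fun k => ?_)) _ _
    positivity
  have hi4 : IntervalIntegrable (fun k => (m : ℝ) / (2 * ε) * (‖symbol n φ k‖ -
      (f N k * symbol n φ k).re)) volume 0 (2 * Real.pi) := by
    have := hc N
    exact Continuous.intervalIntegrable (by fun_prop) _ _
  rw [dist_eq_norm, ← intervalIntegral.integral_sub hi1 hi2]
  have hbound : ‖∫ k in (0 : ℝ)..2 * Real.pi, (f N k * phase (-(r * k)) -
      unitSymbol n φ k * phase (-(r * k)))‖ ≤ ∫ k in (0 : ℝ)..2 * Real.pi,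
      (2 * (1 + (m : ℝ) * ‖symbol n φ k‖)⁻¹ +
      (2 * m * ε + m / (2 * ε) * (‖symbol n φ k‖ - (f N k * symbol n φ k).re))) := by
    refine intervalIntegral.norm_integral_le_of_norm_le hpi.le
      (Filter.Eventually.of_forall fun k _ => ?_)
      (hi3.add ((intervalIntegrable_const).add hi4))
    rw [← sub_mul, norm_mul, norm_phase, mul_one]
    exact norm_sub_unitSymbol_le (h2 k) k (Nat.cast_nonneg m) hε0
  refine hbound.trans_lt ?_
  rw [intervalIntegral.integral_add hi3 ((intervalIntegrable_const).add hi4),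
    intervalIntegral.integral_add intervalIntegrable_const hi4, intervalIntegral.integral_const,
    sub_zero, smul_eq_mul]
  have h5 := intervalIntegral.integral_const_mul (μ := volume) (a := 0) (b := 2 * Real.pi) 2
    (fun k => (1 + (m : ℝ) * ‖symbol n φ k‖)⁻¹)
  have h6 := intervalIntegral.integral_const_mul (μ := volume) (a := 0) (b := 2 * Real.pi)
    ((m : ℝ) / (2 * ε)) (fun k => ‖symbol n φ k‖ - (f N k * symbol n φ k).re)
  rw [h5, h6]
  linarith

end Minimizers

end ClusterIsing

namespace ClusterIsing

open Matrix

open MeasureTheory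

/-! ### Convergence of Riemann sums -/

section RiemannSums

theorem norm_integral_sub_riemannSum_le {g : ℝ → ℝ} (hg : Continuous g) {L ε δ : ℝ} (hL : 0 < L)
    (h : ∀ x ∈ Set.Icc 0 L, ∀ y ∈ Set.Icc 0 L, |x - y| ≤ δ → |g x - g y| ≤ ε)
    {N : ℕ} (hN : 0 < N) (hδ : L / N ≤ δ) :
    |(∫ x in (0 : ℝ)..L, g x) - L / N * ∑ j ∈ Finset.range N, g (L / N * j)| ≤ L * ε := by
  have hN0 : (0 : ℝ) < N := Nat.cast_pos.2 hN
  set s := L / N with hs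
  have hs0 : 0 < s := div_pos hL hN0
  have hsN : s * N = L := by rw [hs]; field_simp
  have h1 : ∫ x in (0 : ℝ)..L, g x =
      ∑ j ∈ Finset.range N, ∫ x in (s * j)..(s * (j + 1 : ℕ)), g x := by
    rw [intervalIntegral.sum_integral_adjacent_intervals (a := fun j : ℕ => s * j)
      (fun j _ => hg.intervalIntegrable _ _), hsN]
    simp
  rw [h1, Finset.mul_sum, ← Finset.sum_sub_distrib]
  refine (Finset.abs_sum_le_sum_abs _ _).trans ?_
  have h2 : ∀ j ∈ Finset.range N,
      |(∫ x in (s * j)..(s * (j + 1 : ℕ)), g x) - s * g (s * j)| ≤ ε * s := by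
    intro j hj
    have hjN : (j : ℝ) + 1 ≤ N := by exact_mod_cast Finset.mem_range.1 hj
    have hlen : s * (j + 1 : ℕ) - s * j = s := by push_cast; ring
    have h3 : s * g (s * j) = ∫ _ in (s * j)..(s * (j + 1 : ℕ)), g (s * j) := by
      rw [intervalIntegral.integral_const, hlen, smul_eq_mul]
    rw [h3, ← intervalIntegral.integral_sub (hg.intervalIntegrable _ _) intervalIntegrable_const,
      ← Real.norm_eq_abs]
    have h4 := intervalIntegral.norm_integral_le_of_norm_le_const (a := s * j)
      (b := s * (j + 1 : ℕ)) (f := fun x => g x - g (s * j)) (C := ε) ?_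
    · rwa [hlen, abs_of_pos hs0] at h4
    · intro x hx
      rw [Set.uIoc_of_le (by push_cast; nlinarith)] at hx
      have hxl := hx.1
      have hxr := hx.2
      push_cast at hxr
      have hj0 : 0 ≤ s * (j : ℝ) := by positivity
      have hLe : s * ((j : ℝ) + 1) ≤ L := by rw [← hsN]; gcongr
      refine h x ⟨by linarith, by linarith⟩ _ ⟨hj0, by linarith⟩ ?_
      rw [abs_of_nonneg (by linarith)]
      linarith
  refine (Finset.sum_le_sum h2).trans ?_
  rw [Finset.sum_const, Finset.card_range, nsmul_eq_mul, ← hsN]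
  exact le_of_eq (by ring)

theorem tendsto_riemannSum {g : ℝ → ℝ} (hg : Continuous g) {L : ℝ} (hL : 0 < L) :
    Tendsto (fun N : ℕ => L / N * ∑ j ∈ Finset.range N, g (L / N * j)) atTop
      (𝓝 (∫ x in (0 : ℝ)..L, g x)) := by
  rw [Metric.tendsto_atTop]
  intro η hη
  have hu := (isCompact_Icc (a := (0 : ℝ)) (b := L)).uniformContinuousOn_of_continuous hg.continuousOn
  rw [Metric.uniformContinuousOn_iff_le] at hu
  obtain ⟨δ, hδ, h⟩ := hu (η / (2 * L)) (by positivity)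
  have hlim := tendsto_const_div_atTop_nhds_zero_nat L
  obtain ⟨N₀, hN₀⟩ := eventually_atTop.1 ((tendsto_order.1 hlim).2 δ hδ)
  refine ⟨max N₀ 1, fun N hN => ?_⟩
  have h1 := norm_integral_sub_riemannSum_le hg hL
    (fun x hx y hy hxy => h x hx y hy hxy) (le_of_max_le_right hN) (hN₀ N (le_of_max_le_left hN)).le
  rw [Real.dist_eq, abs_sub_comm]
  refine h1.trans_lt ?_
  rw [show L * (η / (2 * L)) = η / 2 by field_simp]
  linarith

end RiemannSums

/-! ### Fejér sums and diagonal averages of correlations -/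

section DiagonalSums

/-- The Fejér sum of a matrix of correlations. -/
noncomputable def fejer (N : ℕ) (c : ℕ → ℕ → ℂ) (k : ℝ) : ℂ :=
  (1 / N : ℂ) * ∑ i ∈ Finset.range N, ∑ j ∈ Finset.range N, phase (((i : ℝ) - j) * k) * c i j

/-- The sum of the entries of a matrix on a diagonal. -/
def diagSum (N : ℕ) (c : ℕ → ℕ → ℂ) (r : ℤ) : ℂ :=
  ∑ i ∈ Finset.range N, ∑ j ∈ Finset.range N, if (i : ℤ) - j = r then c i j else 0

theorem continuous_fejer (N : ℕ) (c : ℕ → ℕ → ℂ) : Continuous (fejer N c) := by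
  have := continuous_phase
  unfold fejer
  fun_prop

theorem integral_fejer (N : ℕ) (c : ℕ → ℕ → ℂ) (r : ℤ) :
    ∫ k in (0 : ℝ)..2 * Real.pi, fejer N c k * phase (-(r * k)) =
      ((2 * Real.pi : ℝ) : ℂ) * ((1 / N : ℂ) * diagSum N c r) := by
  have h1 : ∀ k : ℝ, fejer N c k * phase (-(r * k)) = (1 / N : ℂ) * ∑ i ∈ Finset.range N,
      ∑ j ∈ Finset.range N, c i j * phase (((i : ℤ) - j - r : ℤ) * k) := fun k => by
    rw [fejer, mul_assoc, Finset.sum_mul]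
    congr 1
    refine Finset.sum_congr rfl fun i _ => ?_
    rw [Finset.sum_mul]
    refine Finset.sum_congr rfl fun j _ => ?_
    have : phase (((i : ℤ) - j - r : ℤ) * k) = phase (((i : ℝ) - j) * k) * phase (-(r * k)) := by
      rw [← phase_add]; push_cast; congr 1; ring
    rw [this]; ring
  have hph := continuous_phase
  have hc : ∀ i j : ℕ, Continuous fun k : ℝ => c i j * phase (((i : ℤ) - j - r : ℤ) * k) :=
    fun i j => by fun_prop
  simp only [h1]
  rw [intervalIntegral.integral_const_mul, intervalIntegral.integral_finsetSum (fun i _ =>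
    (continuous_finsetSum _ fun j _ => hc i j).intervalIntegrable _ _), diagSum, mul_left_comm]
  congr 1
  rw [Finset.mul_sum]
  refine Finset.sum_congr rfl fun i _ => ?_
  rw [intervalIntegral.integral_finsetSum (fun j _ => (hc i j).intervalIntegrable _ _),
    Finset.mul_sum]
  refine Finset.sum_congr rfl fun j _ => ?_
  rw [intervalIntegral.integral_const_mul, integral_phase]
  simp only [sub_eq_zero]
  split_ifs <;> ring

theorem diagSum_natCast (N : ℕ) (c : ℕ → ℕ → ℂ) (d : ℕ) : diagSum N c d =
    ∑ j ∈ Finset.range N, if j + d < N then c (j + d) j else 0 := by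
  rw [diagSum, Finset.sum_comm]
  refine Finset.sum_congr rfl fun j _ => ?_
  have : ∀ i : ℕ, ((i : ℤ) - j = d) ↔ i = j + d := fun i => by omega
  simp only [this, Finset.sum_ite_eq', Finset.mem_range]

theorem diagSum_neg_natCast (N : ℕ) (c : ℕ → ℕ → ℂ) (d : ℕ) : diagSum N c (-d) =
    ∑ i ∈ Finset.range N, if i + d < N then c i (i + d) else 0 := by
  rw [diagSum]
  refine Finset.sum_congr rfl fun i _ => ?_
  have : ∀ j : ℕ, ((i : ℤ) - j = -d) ↔ j = i + d := fun j => by omega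
  simp only [this, Finset.sum_ite_eq', Finset.mem_range]

/-- Only the last $d$ indices contribute; this is how the couplings that wrap around the ring are
discarded. -/
theorem norm_sum_sub_sum_le {N d : ℕ} {f g : ℕ → ℂ} {c : ℝ} (h1 : ∀ j, j + d < N → f j = g j)
    (h2 : ∀ j < N, ‖f j - g j‖ ≤ c) (hc : 0 ≤ c) :
    ‖∑ j ∈ Finset.range N, f j - ∑ j ∈ Finset.range N, g j‖ ≤ d * c := by
  rw [← Finset.sum_sub_distrib]
  rw [← Finset.sum_filter_of_ne (p := fun j => N ≤ j + d)]
  · refine (norm_sum_le_of_le (n := fun _ => c) _ fun j hj => ?_).trans ?_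
    · exact h2 j (Finset.mem_range.1 (Finset.mem_filter.1 hj).1)
    · rw [Finset.sum_const, nsmul_eq_mul]
      gcongr
      have : (Finset.range N).filter (fun j => N ≤ j + d) ⊆ Finset.Ico (N - d) N := fun j hj => by
        simp only [Finset.mem_filter, Finset.mem_range, Finset.mem_Ico] at hj ⊢
        omega
      refine (Finset.card_le_card this).trans ?_
      rw [Nat.card_Ico]
      omega
  · intro j _ hj
    by_contra h
    exact hj (by rw [h1 j (by omega), sub_self])

theorem norm_diagSum_div_sub_le {N d : ℕ} (hN : 0 < N) {f : ℕ → ℂ} {z : ℂ}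
    (h : ∀ j, j + d < N → f j = z) (hz : ‖z‖ ≤ 1) :
    ‖(1 / N : ℂ) * (∑ j ∈ Finset.range N, if j + d < N then f j else 0) - z‖ ≤ d / N := by
  have hN0 : (0 : ℝ) < N := Nat.cast_pos.2 hN
  have hN1 : (N : ℂ) ≠ 0 := Nat.cast_ne_zero.2 hN.ne'
  have h1 := norm_sum_sub_sum_le (N := N) (d := d) (c := 1)
    (f := fun j => if j + d < N then f j else 0) (g := fun _ => z)
    (fun j hj => by simp only [if_pos hj, h j hj]) (fun j _ => ?_) zero_le_one
  · rw [Finset.sum_const, Finset.card_range, nsmul_eq_mul, mul_one] at h1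
    have h2 : (1 / N : ℂ) * (∑ j ∈ Finset.range N, if j + d < N then f j else 0) - z =
        (1 / N : ℂ) * ((∑ j ∈ Finset.range N, if j + d < N then f j else 0) - N * z) := by
      field_simp
    rw [h2, norm_mul, norm_div, norm_one, Complex.norm_natCast, one_div, div_eq_inv_mul]
    gcongr
  · by_cases hj : j + d < N
    · simp [hj, h j hj]
    · simpa [hj] using hz

end DiagonalSums

/-! ### Matching lower and upper bounds for the ground energy -/

section EnergyBounds

variable {N n : ℕ} {J φ : ℝ}

/-- At most $1+(n+1)$ couplings wrap around, each changing by at most 2 in modulus, whence $2n+4$.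
No parity-dependent boundary condition is ever resolved. -/
theorem norm_state_hamiltonian_sub_le (hN : n + 2 ≤ N) (hJ : 0 < J) {ω : Op N →ₗ[ℂ] ℂ}
    (hω : IsState ω) {g₁ g₂ : ℕ → ℂ}
    (h₁ : ∀ j, j + 1 < N → ω (opB N (j + 1) * opA N j) = g₁ j)
    (h₂ : ∀ j, j + (n + 1) < N → ω (opB N j * opA N (j + (n + 1))) = g₂ j)
    (hg₁ : ∀ j, ‖g₁ j‖ ≤ 1) (hg₂ : ∀ j, ‖g₂ j‖ ≤ 1) :
    ‖ω (hamiltonian N n J φ) - J * (Real.sin φ * ∑ j ∈ Finset.range N, g₁ j -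
      Real.cos φ * ∑ j ∈ Finset.range N, g₂ j)‖ ≤ J * (2 * n + 4) := by
  have hI : ∀ j, ‖ω (isingTerm N j)‖ ≤ 1 := fun j => hω.norm_le_one (by
    rw [isingTerm_conjTranspose, isingTerm_mul_self])
  have hC : ∀ j, ‖ω (clusterTerm N n j)‖ ≤ 1 := fun j => hω.norm_le_one (by
    rw [clusterTerm_conjTranspose hN, clusterTerm_mul_self hN])
  have e1 := norm_sum_sub_sum_le (N := N) (d := 1) (c := 2) (f := fun j => ω (isingTerm N j))
    (g := g₁) (fun j hj => by simp only [isingTerm_eq hj, h₁ j hj])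
    (fun j _ => (norm_sub_le _ _).trans (by linarith [hI j, hg₁ j])) zero_le_two
  have e2 := norm_sum_sub_sum_le (N := N) (d := n + 1) (c := 2)
    (f := fun j => ω (clusterTerm N n j)) (g := g₂)
    (fun j hj => by simp only [clusterTerm_eq hj, h₂ j hj])
    (fun j _ => (norm_sub_le _ _).trans (by linarith [hC j, hg₂ j])) zero_le_two
  push_cast at e2
  have heq : ω (hamiltonian N n J φ) - J * (Real.sin φ * ∑ j ∈ Finset.range N, g₁ j -
      Real.cos φ * ∑ j ∈ Finset.range N, g₂ j) =
      J * (Real.sin φ * (∑ j ∈ Finset.range N, ω (isingTerm N j) - ∑ j ∈ Finset.range N, g₁ j) -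
        Real.cos φ * (∑ j ∈ Finset.range N, ω (clusterTerm N n j) -
          ∑ j ∈ Finset.range N, g₂ j)) := by
    rw [hamiltonian_eq, map_smul, map_sub, map_smul, map_smul, map_sum, map_sum]
    simp only [smul_eq_mul]
    ring
  rw [heq, norm_mul, Complex.norm_real, Real.norm_of_nonneg hJ.le]
  refine mul_le_mul_of_nonneg_left ?_ hJ.le
  refine (norm_sub_le _ _).trans ?_
  rw [norm_mul, norm_mul, Complex.norm_real, Complex.norm_real, Real.norm_eq_abs, Real.norm_eq_abs]
  have a1 := mul_le_mul (Real.abs_sin_le_one φ) e1 (norm_nonneg _) zero_le_one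
  have a2 := mul_le_mul (Real.abs_cos_le_one φ) e2 (norm_nonneg _) zero_le_one
  push_cast at a1
  linarith

/-- The correlations `⟨B_i A_j⟩`. -/
noncomputable def corrBA (N : ℕ) (ω : Op N →ₗ[ℂ] ℂ) (i j : ℕ) : ℂ := ω (opB N i * opA N j)

theorem norm_corrBA_le {ω : Op N →ₗ[ℂ] ℂ} (hω : IsState ω) {i j : ℕ} (hi : i < N) (hj : j < N) :
    ‖corrBA N ω i j‖ ≤ 1 := hω.norm_le_one (opB_mul_opA_unitary hi hj)

theorem integral_fejer_mul_symbol (c : ℕ → ℕ → ℂ) :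
    ∫ k in (0 : ℝ)..2 * Real.pi, fejer N c k * symbol n φ k =
      ((2 * Real.pi : ℝ) : ℂ) * ((1 / N : ℂ) * (Real.cos φ * diagSum N c (-(n + 1 : ℕ)) -
        Real.sin φ * diagSum N c (1 : ℕ))) := by
  have hph := continuous_phase
  have hf := continuous_fejer N c
  have h1 : ∀ k : ℝ, fejer N c k * symbol n φ k =
      Real.cos φ * (fejer N c k * phase (-((-(n + 1 : ℕ) : ℤ) * k))) -
      Real.sin φ * (fejer N c k * phase (-(((1 : ℕ) : ℤ) * k))) := fun k => by
    rw [symbol, show (-(((-(n + 1 : ℕ) : ℤ) : ℝ) * k)) = ((n : ℝ) + 1) * k by push_cast; ring,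
      show (-((((1 : ℕ) : ℤ) : ℝ) * k)) = -k by push_cast; ring]
    ring
  simp only [h1]
  rw [intervalIntegral.integral_sub (Continuous.intervalIntegrable (by fun_prop) _ _)
    (Continuous.intervalIntegrable (by fun_prop) _ _), intervalIntegral.integral_const_mul,
    intervalIntegral.integral_const_mul, integral_fejer, integral_fejer]
  ring

/-- The two exponentials in the symbol pick out the diagonals $-(n+1)$ and $1$ of the correlation
matrix, which are the ones entering the bulk energy. -/
theorem le_re_state_hamiltonian (hN : n + 2 ≤ N) (hJ : 0 < J) {ω : Op N →ₗ[ℂ] ℂ} (hω : IsState ω) :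
    -(J * N * ((2 * Real.pi)⁻¹ * ∫ k in (0 : ℝ)..2 * Real.pi,
      (fejer N (corrBA N ω) k * symbol n φ k).re)) - J * (2 * n + 4) ≤
      (ω (hamiltonian N n J φ)).re := by
  have hN0 : (N : ℂ) ≠ 0 := Nat.cast_ne_zero.2 (by omega)
  have hpi : (Real.pi : ℂ) ≠ 0 := Complex.ofReal_ne_zero.2 Real.pi_ne_zero
  have h := norm_state_hamiltonian_sub_le (J := J) (φ := φ) hN hJ hω
    (g₁ := fun j => if j + 1 < N then corrBA N ω (j + 1) j else 0)
    (g₂ := fun j => if j + (n + 1) < N then corrBA N ω j (j + (n + 1)) else 0)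
    (fun j hj => by simp only [if_pos hj, corrBA]) (fun j hj => by simp only [if_pos hj, corrBA])
    (fun j => by
      split_ifs with hj
      · exact norm_corrBA_le hω hj (by omega)
      · simp)
    (fun j => by
      split_ifs with hj
      · exact norm_corrBA_le hω (by omega) hj
      · simp)
  rw [← diagSum_natCast, ← diagSum_neg_natCast] at h
  have hI := integral_fejer_mul_symbol (N := N) (n := n) (φ := φ) (corrBA N ω)
  have hcont : Continuous fun k => fejer N (corrBA N ω) k * symbol n φ k :=
    (continuous_fejer _ _).mul continuous_symbol
  have hre : ∫ k in (0 : ℝ)..2 * Real.pi, (fejer N (corrBA N ω) k * symbol n φ k).re =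
      (∫ k in (0 : ℝ)..2 * Real.pi, fejer N (corrBA N ω) k * symbol n φ k).re :=
    Complex.reCLM.intervalIntegral_comp_comm (hcont.intervalIntegrable _ _)
  have h2 : (J : ℂ) * (Real.sin φ * diagSum N (corrBA N ω) (1 : ℕ) -
      Real.cos φ * diagSum N (corrBA N ω) (-(n + 1 : ℕ))) =
      ((-(J * N * (2 * Real.pi)⁻¹) : ℝ) : ℂ) *
        ∫ k in (0 : ℝ)..2 * Real.pi, fejer N (corrBA N ω) k * symbol n φ k := by
    rw [hI]
    push_cast
    field_simp
    ring
  rw [h2] at h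
  have h3 := (abs_le.1 ((Complex.abs_re_le_norm _).trans h)).1
  rw [Complex.sub_re, Complex.re_ofReal_mul, ← hre] at h3
  linarith

/-- The Fejér sum is $\frac1N\omega(X^\dagger Y)$ for Fourier modes $X$ of the $B$'s and $Y$ of the
$A$'s. Because off-diagonal $AA$ and $BB$ correlations vanish, $\omega(X^\dagger X)=\omega(Y^\dagger
Y)=N$, and Cauchy–Schwarz applies. -/
theorem norm_fejer_corrBA_le (hN : n + 2 ≤ N) (k : ℝ) :
    ‖fejer N (corrBA N (groundState N n J φ)) k‖ ≤ 1 := by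
  have hN0 : (0 : ℝ) < N := Nat.cast_pos.2 (by omega)
  have hω := isState_groundState (J := J) (φ := φ) hN
  set ω := groundState N n J φ with hωdef
  set X : Op N := ∑ i ∈ Finset.range N, phase (-(i * k)) • -opB N i with hX
  set Y : Op N := ∑ j ∈ Finset.range N, phase (-(j * k)) • opA N j with hY
  have hXc : Xᴴ = ∑ i ∈ Finset.range N, phase (i * k) • opB N i := by
    rw [hX, Matrix.conjTranspose_sum]
    refine Finset.sum_congr rfl fun i hi => ?_
    rw [Matrix.conjTranspose_smul, Matrix.conjTranspose_neg,
      opB_conjTranspose (Finset.mem_range.1 hi), neg_neg, Complex.star_def, conj_phase, neg_neg]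
  have hYc : Yᴴ = ∑ i ∈ Finset.range N, phase (i * k) • opA N i := by
    rw [hY, Matrix.conjTranspose_sum]
    refine Finset.sum_congr rfl fun i hi => ?_
    rw [Matrix.conjTranspose_smul, opA_conjTranspose (Finset.mem_range.1 hi), Complex.star_def,
      conj_phase, neg_neg]
  have hphase : ∀ i : ℕ, phase (i * k) * phase (-(i * k)) = 1 := fun i => by
    rw [← phase_add, add_neg_cancel, phase_zero]
  have hXX : ω (Xᴴ * X) = N := by
    rw [hXc, hX, Finset.sum_mul_sum, map_sum]
    have : ∀ i ∈ Finset.range N, ω (∑ j ∈ Finset.range N, phase (i * k) • opB N i *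
        phase (-(j * k)) • -opB N j) = 1 := fun i hi => by
      rw [map_sum, Finset.sum_eq_single i]
      · rw [Matrix.smul_mul, Matrix.mul_smul, smul_smul, hphase, one_smul, mul_neg,
          opB_mul_self (Finset.mem_range.1 hi), neg_neg, hω.map_one]
      · intro j hj hji
        rw [Matrix.smul_mul, Matrix.mul_smul, smul_smul, map_smul, mul_neg, map_neg, hωdef,
          groundState_opB_opB hN (Finset.mem_range.1 hi) (Finset.mem_range.1 hj) hji.symm, neg_zero,
          smul_zero]
      · exact fun h => (h hi).elim
    rw [Finset.sum_congr rfl this]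
    simp
  have hYY : ω (Yᴴ * Y) = N := by
    rw [hYc, hY, Finset.sum_mul_sum, map_sum]
    have : ∀ i ∈ Finset.range N, ω (∑ j ∈ Finset.range N, phase (i * k) • opA N i *
        phase (-(j * k)) • opA N j) = 1 := fun i hi => by
      rw [map_sum, Finset.sum_eq_single i]
      · rw [Matrix.smul_mul, Matrix.mul_smul, smul_smul, hphase, one_smul,
          opA_mul_self (Finset.mem_range.1 hi), hω.map_one]
      · intro j hj hji
        rw [Matrix.smul_mul, Matrix.mul_smul, smul_smul, map_smul, hωdef,
          groundState_opA_opA hN (Finset.mem_range.1 hi) (Finset.mem_range.1 hj) hji.symm, smul_zero]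
      · exact fun h => (h hi).elim
    rw [Finset.sum_congr rfl this]
    simp
  have hXY : fejer N (corrBA N ω) k = (1 / N : ℂ) * ω (Xᴴ * Y) := by
    rw [fejer, hXc, hY, Finset.sum_mul_sum, map_sum]
    congr 1
    refine Finset.sum_congr rfl fun i _ => ?_
    rw [map_sum]
    refine Finset.sum_congr rfl fun j _ => ?_
    rw [Matrix.smul_mul, Matrix.mul_smul, smul_smul, map_smul, smul_eq_mul, ← phase_add, corrBA]
    congr 2; ring
  have h := hω.norm_le X Y
  rw [hXX, hYY, Complex.natCast_re] at h
  rw [hXY, norm_mul, norm_div, norm_one, Complex.norm_natCast, one_div, inv_mul_le_iff₀ hN0]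
  linarith

/-- The symbol as a function of the discrete momenta. -/
noncomputable def discreteSymbol (N n : ℕ) [NeZero N] (φ : ℝ) (p : ZMod N) : ℂ :=
  Real.cos φ * ZMod.stdAddChar (p * ((n : ZMod N) + 1)) - Real.sin φ * ZMod.stdAddChar (-p)

theorem discreteSymbol_natCast [NeZero N] (j : ℕ) :
    discreteSymbol N n φ (j : ZMod N) = symbol n φ (2 * Real.pi / N * j) := by
  have h1 := ZMod.stdAddChar_coe (N := N) ((j * (n + 1) : ℕ) : ℤ)
  have h2 := ZMod.stdAddChar_coe (N := N) (-(j : ℕ) : ℤ)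
  push_cast at h1 h2
  rw [discreteSymbol, symbol, h1, h2, phase, phase]
  push_cast
  congr 3 <;> ring_nf

theorem sum_norm_discreteSymbol [NeZero N] :
    ∑ p : ZMod N, ‖discreteSymbol N n φ p‖ =
      ∑ j ∈ Finset.range N, ‖symbol n φ (2 * Real.pi / N * j)‖ := by
  rw [← sum_range_natCast_zmod]
  simp only [discreteSymbol_natCast]

theorem conj_discreteSymbol [NeZero N] (p : ZMod N) :
    (starRingEnd ℂ) (discreteSymbol N n φ p) = discreteSymbol N n φ (-p) := by
  rw [discreteSymbol, map_sub, map_mul (starRingEnd ℂ), map_mul (starRingEnd ℂ), conj_stdAddChar, conj_stdAddChar,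
    Complex.conj_ofReal, Complex.conj_ofReal, discreteSymbol, neg_mul]

theorem norm_invDFT_le [NeZero N] {v : ZMod N → ℂ} (hv : ∀ p, ‖v p‖ = 1) (x : ZMod N) :
    ‖invDFT v x‖ ≤ 1 := by
  have hN0 : (0 : ℝ) < N := Nat.cast_pos.2 (NeZero.pos N)
  rw [invDFT, norm_mul, norm_div, norm_one, Complex.norm_natCast, one_div, inv_mul_le_iff₀ hN0,
    mul_one]
  refine (norm_sum_le _ _).trans ?_
  have : ∀ p : ZMod N, ‖v p * ZMod.stdAddChar (p * x)‖ = 1 := fun p => by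
    rw [norm_mul, hv, ZMod.stdAddChar_apply, Circle.norm_coe, one_mul]
  rw [Finset.sum_congr rfl fun p _ => this p]
  simp [ZMod.card]

theorem groundEnergy_le_sum (hN : n + 2 ≤ N) (hJ : 0 < J) :
    groundEnergy N n J φ ≤
      -(J * ∑ j ∈ Finset.range N, ‖symbol n φ (2 * Real.pi / N * j)‖) + J * (2 * n + 4) := by
  have : NeZero N := ⟨by omega⟩
  have hN0 : (N : ℂ) ≠ 0 := Nat.cast_ne_zero.2 (NeZero.ne N)
  -- The optimal phase for each momentum; the value 1 at zeros of the symbol keeps $v$ unimodular,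
  -- so that the circulant matrix is orthogonal.
  set v : ZMod N → ℂ := fun p => if discreteSymbol N n φ p = 0 then 1 else
    (starRingEnd ℂ) (discreteSymbol N n φ p) / ‖discreteSymbol N n φ p‖ with hv
  have hv1 : ∀ p, ‖v p‖ = 1 := fun p => by
    simp only [hv]
    split_ifs with h
    · simp
    · rw [norm_div, Complex.norm_conj, Complex.norm_real, norm_norm]
      exact div_self (norm_ne_zero_iff.2 h)
  have hv2 : ∀ p, (starRingEnd ℂ) (v p) = v (-p) := fun p => by
    simp only [hv, ← conj_discreteSymbol, map_eq_zero]
    split_ifs with h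
    · simp
    · rw [map_div₀, Complex.conj_ofReal, Complex.norm_conj]
  have hv3 : ∀ p, v p * discreteSymbol N n φ p = (‖discreteSymbol N n φ p‖ : ℂ) := fun p => by
    simp only [hv]
    split_ifs with h
    · simp [h]
    · have hne : (‖discreteSymbol N n φ p‖ : ℂ) ≠ 0 :=
        Complex.ofReal_ne_zero.2 (norm_ne_zero_iff.2 h)
      rw [div_mul_eq_mul_div, mul_comm, Complex.mul_conj, Complex.normSq_eq_norm_sq]
      push_cast
      field_simp
  obtain ⟨ψ, hψ, hcorr⟩ := exists_vecState_invDFT hv2 hv1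
  have h := norm_state_hamiltonian_sub_le (J := J) (φ := φ) hN hJ (isState_vecState hψ)
    (g₁ := fun _ => invDFT v (-1)) (g₂ := fun _ => invDFT v ((n : ZMod N) + 1))
    (fun j hj => by
      rw [hcorr _ hj _ (by omega)]; congr 1; push_cast; ring)
    (fun j hj => by
      rw [hcorr _ (by omega) _ hj]; congr 1; push_cast; ring)
    (fun _ => norm_invDFT_le hv1 _) (fun _ => norm_invDFT_le hv1 _)
  have hsum : (J : ℂ) * (Real.sin φ * ∑ _j ∈ Finset.range N, invDFT v (-1) -
      Real.cos φ * ∑ _j ∈ Finset.range N, invDFT v ((n : ZMod N) + 1)) =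
      ((-(J * ∑ j ∈ Finset.range N, ‖symbol n φ (2 * Real.pi / N * j)‖) : ℝ) : ℂ) := by
    rw [← sum_norm_discreteSymbol]
    push_cast
    simp only [← hv3]
    rw [Finset.sum_const, Finset.sum_const, Finset.card_range, nsmul_eq_mul, nsmul_eq_mul, invDFT,
      invDFT]
    have e1 : ∑ p, v p * discreteSymbol N n φ p =
        Real.cos φ * ∑ p, v p * ZMod.stdAddChar (p * ((n : ZMod N) + 1)) -
        Real.sin φ * ∑ p, v p * ZMod.stdAddChar (p * (-1 : ZMod N)) := by
      rw [Finset.mul_sum, Finset.mul_sum, ← Finset.sum_sub_distrib]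
      refine Finset.sum_congr rfl fun p _ => ?_
      rw [discreteSymbol, mul_neg_one]
      ring
    rw [e1]
    push_cast
    field_simp
    ring
  rw [hsum] at h
  have h3 := (abs_le.1 ((Complex.abs_re_le_norm _).trans h)).2
  rw [Complex.sub_re, Complex.ofReal_re] at h3
  have := groundEnergy_le_vecState (J := J) (φ := φ) hN hψ
  linarith

end EnergyBounds

/-! ### The two-point function in the thermodynamic limit -/

section TwoPointFunction

variable {n : ℕ} {J φ : ℝ}

/-- The integrand is nonnegative because $|f_N|\le1$. The two energy bounds make its integral at
most the Riemann-sum error plus $O(1/N)$; the constant $4n+8$ is twice the boundary cost $2n+4$. -/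
theorem tendsto_energy_defect (hJ : 0 < J) :
    Tendsto (fun N : ℕ => ∫ k in (0 : ℝ)..2 * Real.pi,
      (‖symbol n φ k‖ - (fejer N (corrBA N (groundState N n J φ)) k * symbol n φ k).re))
      atTop (𝓝 0) := by
  have hpi := Real.two_pi_pos
  have hs := continuous_symbol (n := n) (φ := φ)
  have hR := tendsto_riemannSum hs.norm hpi
  have hlim : Tendsto (fun N : ℕ => ((∫ k in (0 : ℝ)..2 * Real.pi, ‖symbol n φ k‖) -
      2 * Real.pi / N * ∑ j ∈ Finset.range N, ‖symbol n φ (2 * Real.pi / N * j)‖) +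
      2 * Real.pi * (4 * n + 8) / N) atTop (𝓝 0) := by
    have := ((tendsto_const_nhds (x := ∫ k in (0 : ℝ)..2 * Real.pi, ‖symbol n φ k‖)).sub hR).add
      (tendsto_const_div_atTop_nhds_zero_nat (2 * Real.pi * (4 * n + 8)))
    simpa using this
  refine squeeze_zero' ?_ ?_ hlim
  · filter_upwards [eventually_ge_atTop (n + 2)] with N hN
    refine intervalIntegral.integral_nonneg hpi.le fun k _ => ?_
    rw [sub_nonneg]
    refine (Complex.re_le_norm _).trans ?_
    rw [norm_mul]
    exact mul_le_of_le_one_left (norm_nonneg _) (norm_fejer_corrBA_le hN k)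
  · filter_upwards [eventually_ge_atTop (n + 2)] with N hN
    have hN0 : (0 : ℝ) < N := Nat.cast_pos.2 (by omega)
    have hf := continuous_fejer N (corrBA N (groundState N n J φ))
    have hre : Continuous fun k => (fejer N (corrBA N (groundState N n J φ)) k * symbol n φ k).re :=
      Complex.continuous_re.comp (hf.mul hs)
    rw [intervalIntegral.integral_sub (hs.norm.intervalIntegrable _ _)
      (hre.intervalIntegrable _ _)]
    have h1 := le_re_state_hamiltonian (J := J) (φ := φ) hN hJ
      (isState_groundState (J := J) (φ := φ) hN)
    rw [groundState_hamiltonian hN, Complex.ofReal_re] at h1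
    have h2 := groundEnergy_le_sum (J := J) (φ := φ) hN hJ
    set I := ∫ k in (0 : ℝ)..2 * Real.pi,
      (fejer N (corrBA N (groundState N n J φ)) k * symbol n φ k).re with hI
    set S := ∑ j ∈ Finset.range N, ‖symbol n φ (2 * Real.pi / N * j)‖ with hS
    have h3 : J * (S - N * ((2 * Real.pi)⁻¹ * I)) ≤ J * (4 * n + 8) := by linarith
    have h4 := le_of_mul_le_mul_left h3 hJ
    have h5 : 2 * Real.pi / N * (S - N * ((2 * Real.pi)⁻¹ * I)) ≤
        2 * Real.pi / N * (4 * n + 8) := by gcongr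
    have h6 : 2 * Real.pi / N * (S - N * ((2 * Real.pi)⁻¹ * I)) = 2 * Real.pi / N * S - I := by
      field_simp
    rw [h6] at h5
    have h7 : 2 * Real.pi / N * (4 * n + 8) = 2 * Real.pi * (4 * n + 8) / N := by ring
    linarith

theorem tendsto_diagSum (hJ : 0 < J) (r : ℤ) :
    Tendsto (fun N : ℕ => (1 / N : ℂ) * diagSum N (corrBA N (groundState N n J φ)) r)
      atTop (𝓝 (G n φ r : ℂ)) := by
  have h := tendsto_integral_of_energy (n := n) (φ := φ)
    (fun N => continuous_fejer N (corrBA N (groundState N n J φ)))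
    (by filter_upwards [eventually_ge_atTop (n + 2)] with N hN using norm_fejer_corrBA_le hN)
    (tendsto_energy_defect hJ) r
  simp only [integral_fejer] at h
  have h2 := h.const_mul (1 / (2 * Real.pi) : ℂ)
  rw [← G_eq_integral] at h2
  refine h2.congr fun N => ?_
  have hpi : (Real.pi : ℂ) ≠ 0 := Complex.ofReal_ne_zero.2 Real.pi_ne_zero
  rw [← mul_assoc]
  push_cast
  rw [one_div_mul_cancel (mul_ne_zero two_ne_zero hpi), one_mul]

/-- By translation invariance all entries on a diagonal at distance $d$ are equal, and there are
$N-d$ of them, so the normalized diagonal sum differs from a single entry by at most $d/N$. -/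
theorem tendsto_groundState_opB_opA (hJ : 0 < J) (i k : ℕ) :
    Tendsto (fun N : ℕ => groundState N n J φ (opB N i * opA N k)) atTop
      (𝓝 (G n φ ((i : ℤ) - k) : ℂ)) := by
  obtain ⟨d, he⟩ : ∃ d : ℕ, (i : ℤ) - k = d ∨ (i : ℤ) - k = -d := ⟨_, Int.natAbs_eq _⟩
  have h1 := tendsto_diagSum (n := n) (φ := φ) hJ ((i : ℤ) - k)
  have h2 : Tendsto (fun N : ℕ => (d : ℝ) / N) atTop (𝓝 0) := tendsto_const_div_atTop_nhds_zero_nat _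
  have h3 : Tendsto (fun N : ℕ => (1 / N : ℂ) *
      diagSum N (corrBA N (groundState N n J φ)) ((i : ℤ) - k) -
      groundState N n J φ (opB N i * opA N k)) atTop (𝓝 0) := by
    refine squeeze_zero_norm' ?_ h2
    filter_upwards [eventually_ge_atTop (n + 2), eventually_gt_atTop i, eventually_gt_atTop k]
      with N hN hi hk
    have hz := norm_corrBA_le (isState_groundState (J := J) (φ := φ) hN) hi hk
    rcases he with he | he
    · rw [he, diagSum_natCast]
      exact norm_diagSum_div_sub_le (by omega) (fun j hj =>
        groundState_opB_opA_eq hj (by omega) hi hk (by push_cast; omega)) hz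
    · rw [he, diagSum_neg_natCast]
      exact norm_diagSum_div_sub_le (by omega) (fun j hj =>
        groundState_opB_opA_eq (by omega) hj hi hk (by push_cast; omega)) hz
  have h4 := h1.sub h3
  simpa using h4

end TwoPointFunction

end ClusterIsing

namespace ClusterIsing

open Matrix

/-! ### The σ^z correlations via an almost annihilating operator -/

section FourPointFunction

variable {N n : ℕ} {J φ : ℝ}

/-- Moving $B_j$ through three anticommuting factors leaves only contractions with $B_i$ and $B_k$,
each equal to $-2$ since $B_j^2=-1$. -/
theorem opB_anticomm_cubic {i k j : ℕ} (hi : i < N) (hk : k < N) (hj : j < N) (hik : i ≠ k) :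
    opB N j * (opB N i * opA N k * opB N k) + opB N i * opA N k * opB N k * opB N j =
      (if j = i then (-2 : ℂ) else 0) • (opA N k * opB N k) +
        (if j = k then (-2 : ℂ) else 0) • (opB N i * opA N k) := by
  have hBA := fun l (hl : l < N) => opB_anticomm_opA (N := N) hl hk
  by_cases hji : j = i
  · subst hji
    have h1 : opB N j * opA N k * opB N k * opB N j =
        opB N j * opB N j * (opA N k * opB N k) := by
      rw [mul_assoc _ (opB N k), opB_anticomm_opB hk hj (Ne.symm hik), mul_assoc, mul_neg,
        ← mul_assoc (opA N k), ← neg_mul, ← hBA j hj]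
      simp only [mul_assoc]
    rw [h1, if_pos rfl, if_neg hik, zero_smul, add_zero, ← mul_assoc, ← mul_assoc, mul_assoc _ (opA N k),
      opB_mul_self hj]
    simp only [neg_mul, one_mul]
    module
  · by_cases hjk : j = k
    · subst hjk
      have h1 : opB N j * (opB N i * opA N j * opB N j) = opB N i * opA N j * opB N j * opB N j := by
        rw [← mul_assoc, ← mul_assoc, opB_anticomm_opB hk hi hji, neg_mul, mul_assoc _ (opB N j),
          hBA j hk, mul_neg, neg_neg, ← mul_assoc]
      rw [h1, if_neg hji, if_pos rfl, zero_smul, zero_add, mul_assoc _ (opB N j) (opB N j),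
        opB_mul_self hk]
      simp only [mul_neg, mul_one]
      module
    · rw [if_neg hji, if_neg hjk, zero_smul, zero_smul, zero_add, ← mul_assoc, ← mul_assoc,
        opB_anticomm_opB hj hi hji, neg_mul, neg_mul, mul_assoc _ (opB N j), hBA j hj, mul_neg,
        neg_mul, neg_neg, ← mul_assoc, mul_assoc _ (opB N j), opB_anticomm_opB hj hk hjk, mul_neg,
        ← mul_assoc, neg_add_cancel]

/-- A substitute for Wick's theorem valid for any real $c$. With $E=A_i+\sum_jc_jB_j$, the terms
containing $E$ are bounded by scaled Cauchy–Schwarz through $\langle E^\dagger E\rangle$, and the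
contractions give the terms in $c_i$ and $c_k$. -/
theorem norm_groundState_σz_σz_le (hN : n + 2 ≤ N) {i k : ℕ} (hi : i < N) (hk : k < N) (hik : i ≠ k)
    (c : ℕ → ℝ) {t : ℝ} (ht : 0 < t) :
    ‖groundState N n J φ (siteOp N σz i * siteOp N σz k)‖ ≤
      (t + t⁻¹ * (1 - 2 * (∑ j ∈ Finset.range N, (c j : ℂ) *
        groundState N n J φ (opB N j * opA N i)) +
        ∑ j ∈ Finset.range N, (c j : ℂ) * c j).re) / 2 + |c i| +
        |c k| * ‖groundState N n J φ (opB N i * opA N k)‖ := by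
  have hω := isState_groundState (J := J) (φ := φ) hN
  set ω := groundState N n J φ with hωdef
  set O : ℕ → ℕ → ℂ := fun _ j => (c j : ℂ) with hO
  set T : Op N := rotB N O 0 with hT
  set X : Op N := opB N i * opA N k * opB N k with hX
  set E : Op N := opA N i + T with hE
  have hTc : Tᴴ = -T := rotB_conjTranspose (fun _ j => Complex.conj_ofReal (c j)) 0
  have hTA : T * opA N i = -(opA N i * T) := rotB_anticomm_opA 0 hi
  have hTT : T * T = -((∑ j ∈ Finset.range N, (c j : ℂ) * c j) • (1 : Op N)) := by
    have h := rotB_mul_add (N := N) (O := O) 0 0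
    rw [← two_smul ℂ, mul_smul, neg_smul, ← smul_neg] at h
    exact smul_right_injective _ (two_ne_zero' ℂ) h
  have hEc : Eᴴ = opA N i - T := by
    rw [hE, Matrix.conjTranspose_add, opA_conjTranspose hi, hTc, sub_eq_add_neg]
  have hEE : ω (Eᴴ * E) = 1 - 2 * (∑ j ∈ Finset.range N, (c j : ℂ) * ω (opB N j * opA N i)) +
        ∑ j ∈ Finset.range N, (c j : ℂ) * c j := by
    have h1 : Eᴴ * E = 1 - (2 : ℂ) • (T * opA N i) +
        (∑ j ∈ Finset.range N, (c j : ℂ) * c j) • (1 : Op N) := by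
      have h2 : opA N i * T = -(T * opA N i) := by rw [hTA, neg_neg]
      rw [hEc, hE, sub_mul, mul_add, mul_add, opA_mul_self hi, hTT, h2, two_smul]
      abel
    have h3 : ω (T * opA N i) = ∑ j ∈ Finset.range N, (c j : ℂ) * ω (opB N j * opA N i) := by
      rw [hT, rotB, Finset.sum_mul, map_sum]
      refine Finset.sum_congr rfl fun j _ => ?_
      rw [Matrix.smul_mul, map_smul, smul_eq_mul]
    rw [h1, map_add, map_sub, map_smul, map_smul, hω.map_one, h3, smul_eq_mul, smul_eq_mul, mul_one]
  have hXc : Xᴴ = opB N k * opA N k * opB N i := by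
    rw [hX, Matrix.conjTranspose_mul, Matrix.conjTranspose_mul, opA_conjTranspose hk,
      opB_conjTranspose hk, opB_conjTranspose hi]
    noncomm_ring
  have hXX : Xᴴ * X = 1 := by
    rw [hXc, hX]
    calc opB N k * opA N k * opB N i * (opB N i * opA N k * opB N k)
        = opB N k * (opA N k * (opB N i * opB N i) * opA N k) * opB N k := by simp only [mul_assoc]
      _ = 1 := by
        rw [opB_mul_self hi, mul_neg_one, neg_mul, opA_mul_self hk, mul_neg_one, neg_mul,
          opB_mul_self hk, neg_neg]
  have hXX' : X * Xᴴ = 1 := mul_eq_one_comm.1 hXX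
  have hAX : opA N i * X = -(X * opA N i) := by
    have hBA : ∀ l < N, opA N i * opB N l = -(opB N l * opA N i) := fun l hl => by
      rw [opB_anticomm_opA hl hi, neg_neg]
    rw [hX, ← mul_assoc, ← mul_assoc, hBA i hi, neg_mul, neg_mul, mul_assoc _ (opA N i),
      opA_anticomm_opA hi hk hik, mul_neg, neg_mul, neg_neg, ← mul_assoc, mul_assoc _ (opA N i),
      hBA k hk, mul_neg, ← mul_assoc]
  have hTX : T * X + X * T = (-2 * (c i : ℂ)) • (opA N k * opB N k) +
      (-2 * (c k : ℂ)) • (opB N i * opA N k) := by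
    rw [hT, rotB, Finset.sum_mul, Finset.mul_sum, ← Finset.sum_add_distrib]
    have h1 : ∀ j ∈ Finset.range N, (O 0 j • opB N j) * X + X * (O 0 j • opB N j) =
        (if j = i then -2 * (c j : ℂ) else 0) • (opA N k * opB N k) +
        (if j = k then -2 * (c j : ℂ) else 0) • (opB N i * opA N k) := fun j hj => by
      rw [Matrix.smul_mul, Matrix.mul_smul, ← smul_add, hX,
        opB_anticomm_cubic hi hk (Finset.mem_range.1 hj) hik, smul_add, smul_smul, smul_smul]
      congr 2 <;> split_ifs <;> simp [hO, mul_comm]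
    rw [Finset.sum_congr rfl h1, Finset.sum_add_distrib, ← Finset.sum_smul, ← Finset.sum_smul,
      Finset.sum_ite_eq', Finset.sum_ite_eq', if_pos (Finset.mem_range.2 hi),
      if_pos (Finset.mem_range.2 hk)]
  -- Here $E^\dagger=A_i-T$ because $T$ is anti-Hermitian, and $A_iX=-XA_i$; hence $E^\dagger
  -- X-XE=2A_iX-(TX+XT)$.
  have hmain : (2 : ℂ) • (opA N i * X) = Eᴴ * X - X * E + ((-2 * (c i : ℂ)) • (opA N k * opB N k) +
      (-2 * (c k : ℂ)) • (opB N i * opA N k)) := by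
    rw [← hTX, hEc, hE, sub_mul, mul_add, two_smul]
    nth_rewrite 2 [hAX]
    abel
  have hsz : siteOp N σz i * siteOp N σz k = opA N i * X := by
    rw [siteOp_σz_eq hi, siteOp_σz_eq hk, hX]
    simp only [mul_assoc]
  set b := (ω (Eᴴ * E)).re with hb
  have b1 : ‖ω (Eᴴ * X)‖ ≤ (t⁻¹ * b + t) / 2 := by
    have := hω.norm_le_scaled E X (inv_pos.2 ht)
    rwa [hXX, hω.map_one, inv_inv, Complex.one_re, mul_one] at this
  have b2 : ‖ω (X * E)‖ ≤ (t + t⁻¹ * b) / 2 := by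
    have := hω.norm_le_scaled Xᴴ E ht
    rwa [Matrix.conjTranspose_conjTranspose, hXX', hω.map_one, Complex.one_re, mul_one] at this
  have b3 : ‖ω (opA N k * opB N k)‖ ≤ 1 := by
    have := hω.norm_le_one (opB_mul_opA_unitary hk hk)
    rwa [opB_anticomm_opA hk hk, map_neg, norm_neg] at this
  have heq : ω (opA N i * X) = (ω (Eᴴ * X) - ω (X * E)) / 2 - c i * ω (opA N k * opB N k) -
      c k * ω (opB N i * opA N k) := by
    have := congrArg ω hmain
    rw [map_smul, map_add, map_sub, map_add, map_smul, map_smul] at this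
    simp only [smul_eq_mul] at this
    linear_combination (1 / 2 : ℂ) * this
  rw [hsz, ← hEE, heq]
  have c1 : ‖(ω (Eᴴ * X) - ω (X * E)) / 2‖ ≤ (t + t⁻¹ * b) / 2 := by
    rw [norm_div, Complex.norm_two]
    have := norm_sub_le (ω (Eᴴ * X)) (ω (X * E))
    linarith
  have c2 : ‖(c i : ℂ) * ω (opA N k * opB N k)‖ ≤ |c i| := by
    rw [norm_mul, Complex.norm_real, Real.norm_eq_abs]
    exact mul_le_of_le_one_right (abs_nonneg _) b3
  have c3 : ‖(c k : ℂ) * ω (opB N i * opA N k)‖ = |c k| * ‖ω (opB N i * opA N k)‖ := by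
    rw [norm_mul, Complex.norm_real, Real.norm_eq_abs]
  refine (norm_sub_le _ _).trans ?_
  rw [c3]
  gcongr
  exact (norm_sub_le _ _).trans (add_le_add c1 c2)

theorem G_zero : G n φ 0 = 0 := by
  refine G_eq_zero 0 ?_
  rintro ⟨l, hl⟩
  have h : ((n : ℤ) + 2) ∣ 1 := ⟨-l, by linear_combination -hl⟩
  have := Int.le_of_dvd one_pos h
  omega

/-- If $r$ and $-r$ were both $1$ modulo $n+2$, then $n+2$ would divide 2, which $n\ge1$ excludes.
-/
theorem G_mul_G_neg (hn : 1 ≤ n) (r : ℤ) : G n φ r * G n φ (-r) = 0 := by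
  by_contra h
  obtain ⟨l, hl⟩ := not_not.1 (mt (G_eq_zero (n := n) (φ := φ) r) (left_ne_zero_of_mul h))
  obtain ⟨m, hm⟩ := not_not.1 (mt (G_eq_zero (n := n) (φ := φ) (-r)) (right_ne_zero_of_mul h))
  have h2 : ((n : ℤ) + 2) ∣ 2 := ⟨-(l + m), by linear_combination -hl - hm⟩
  have := Int.le_of_dvd two_pos h2
  omega

/-- Parseval truncated to a window of sites extending at least $R$ on both sides of $i$. -/
theorem exists_sum_G_sq_gt {ε : ℝ} (hε : 0 < ε) : ∃ R : ℕ, ∀ M i : ℕ, R ≤ i → i + R < M →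
    1 - ε < ∑ j ∈ Finset.range M, G n φ ((j : ℤ) - i) ^ 2 := by
  have h := (tendsto_order.1 (hasSum_G_sq (n := n) (φ := φ))).1 (1 - ε) (by linarith)
  rw [SummationFilter.unconditional_filter] at h
  obtain ⟨s, hs⟩ := eventually_atTop.1 h
  refine ⟨s.sup Int.natAbs, fun M i hi hM => ?_⟩
  have hinj : Set.InjOn (fun j : ℕ => (j : ℤ) - i) (Finset.range M) := fun a _ b _ hab => by
    simp only at hab; omega
  rw [← Finset.sum_image (f := fun r : ℤ => G n φ r ^ 2) hinj]
  refine hs _ fun r hr => Finset.mem_image.2 ⟨(r + i).toNat, ?_, ?_⟩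
  · have := Finset.le_sup (f := Int.natAbs) hr
    rw [Finset.mem_range]; omega
  · have := Finset.le_sup (f := Int.natAbs) hr
    omega

theorem tendsto_groundState_σz_σz (hn : 1 ≤ n) (hJ : 0 < J) {i k : ℕ} (hik : i ≠ k) :
    Tendsto (fun N : ℕ => groundState N n J φ (siteOp N σz i * siteOp N σz k)) atTop (𝓝 0) := by
  rw [tendsto_zero_iff_norm_tendsto_zero, Metric.tendsto_atTop]
  intro η hη
  -- With the Parseval remainder below $t^2$, the limiting bound $(t+t^{-1}(1-S))/2$ is below $t$,
  -- hence below η.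
  set t := η / 2 with ht
  have ht0 : 0 < t := by positivity
  obtain ⟨R, hR⟩ := exists_sum_G_sq_gt (n := n) (φ := φ) (ε := t * t) (by positivity)
  -- Both sites are moved right by $R$ so that the window around $i+R$ uses only nonnegative
  -- indices; $M$ bounds this window and $k+R$. Translation invariance undoes the move at the end.
  set M := i + k + 2 * R + 1 with hM
  have hS := hR M (i + R) (by omega) (by omega)
  set c : ℕ → ℝ := fun j => if j < M then G n φ ((j : ℤ) - (i + R : ℕ)) else 0 with hc
  set S := ∑ j ∈ Finset.range M, G n φ ((j : ℤ) - (i + R : ℕ)) ^ 2 with hSdef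
  have hcM : ∀ j ∈ Finset.range M, c j = G n φ ((j : ℤ) - (i + R : ℕ)) := fun j hj => by
    simp only [hc, if_pos (Finset.mem_range.1 hj)]
  have hci : c (i + R) = 0 := by
    rw [hcM _ (Finset.mem_range.2 (by omega)), sub_self, G_zero]
  have hlim : Tendsto (fun N : ℕ => (t + t⁻¹ * (1 - 2 * (∑ j ∈ Finset.range M, (c j : ℂ) *
        groundState N n J φ (opB N j * opA N (i + R))) +
        ∑ j ∈ Finset.range M, (c j : ℂ) * c j).re) / 2 + |c (i + R)| +
        |c (k + R)| * ‖groundState N n J φ (opB N (i + R) * opA N (k + R))‖) atTop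
      (𝓝 ((t + t⁻¹ * (1 - S)) / 2)) := by
    have h1 : Tendsto (fun N : ℕ => ∑ j ∈ Finset.range M, (c j : ℂ) *
        groundState N n J φ (opB N j * opA N (i + R))) atTop
        (𝓝 (∑ j ∈ Finset.range M, (c j : ℂ) * (G n φ ((j : ℤ) - (i + R : ℕ)) : ℂ))) :=
      tendsto_finsetSum _ fun j _ => (tendsto_groundState_opB_opA hJ j (i + R)).const_mul _
    have h2 := (tendsto_groundState_opB_opA (n := n) (φ := φ) hJ (i + R) (k + R)).norm.const_mul
      |c (k + R)|
    have h3 := ((h1.const_mul 2).const_sub 1).add_const (∑ j ∈ Finset.range M, (c j : ℂ) * c j)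
    have h4 := ((((Complex.continuous_re.tendsto _).comp h3).const_mul t⁻¹).const_add t).div_const 2
    have h5 := (h4.add_const |c (i + R)|).add h2
    -- The surviving contraction is $G_{k-i}G_{i-k}$; the other one, $c_{i+R}=G_0$, already
    -- vanishes.
    have h6 : |c (k + R)| * ‖(G n φ (((i + R : ℕ) : ℤ) - (k + R : ℕ)) : ℂ)‖ = 0 := by
      rw [hcM _ (Finset.mem_range.2 (by omega)), Complex.norm_real, Real.norm_eq_abs, ← abs_mul,
        ← neg_sub, mul_comm, mul_comm, ← neg_sub (((k + R : ℕ) : ℤ)), neg_neg, G_mul_G_neg hn,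
        abs_zero]
    have h7 : 1 - 2 * (∑ j ∈ Finset.range M, (c j : ℂ) * (G n φ ((j : ℤ) - (i + R : ℕ)) : ℂ)) +
        ∑ j ∈ Finset.range M, (c j : ℂ) * c j = ((1 - S : ℝ) : ℂ) := by
      have h8 : ∀ j ∈ Finset.range M, (c j : ℂ) * (G n φ ((j : ℤ) - (i + R : ℕ)) : ℂ) =
          (G n φ ((j : ℤ) - (i + R : ℕ)) : ℂ) ^ 2 := fun j hj => by rw [hcM j hj]; ring
      have h9 : ∀ j ∈ Finset.range M, (c j : ℂ) * c j =
          (G n φ ((j : ℤ) - (i + R : ℕ)) : ℂ) ^ 2 := fun j hj => by rw [hcM j hj]; ring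
      rw [Finset.sum_congr rfl h8, Finset.sum_congr rfl h9, hSdef]
      push_cast
      ring
    rw [h6, h7, Complex.ofReal_re, add_zero] at h5
    have h10 : (t + t⁻¹ * (1 - S)) / 2 + |c (i + R)| = (t + t⁻¹ * (1 - S)) / 2 := by
      rw [hci, abs_zero, add_zero]
    rw [h10] at h5
    exact h5
  have hlt : (t + t⁻¹ * (1 - S)) / 2 < η := by
    have h1 : t⁻¹ * (1 - S) < t⁻¹ * (t * t) := by gcongr; linarith
    rw [inv_mul_cancel_left₀ ht0.ne'] at h1
    rw [show η = 2 * t by rw [ht]; ring]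
    linarith
  obtain ⟨N₀, hN₀⟩ := eventually_atTop.1 ((tendsto_order.1 hlim).2 η hlt)
  refine ⟨max N₀ (M + n + 2), fun N hN => ?_⟩
  have hNM : M + n + 2 ≤ N := le_of_max_le_right hN
  rw [dist_zero_right, norm_norm]
  have hbound := norm_groundState_σz_σz_le (J := J) (φ := φ) (N := N) (n := n) (by omega)
    (i := i + R) (k := k + R) (by omega) (by omega) (by omega) c ht0
  have hsum : ∀ f : ℕ → ℂ, ∑ j ∈ Finset.range N, (c j : ℂ) * f j =
      ∑ j ∈ Finset.range M, (c j : ℂ) * f j := fun f => by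
    refine (Finset.sum_subset (Finset.range_subset_range.2 (by omega)) fun j _ hj => ?_).symm
    simp only [hc, if_neg (fun h => hj (Finset.mem_range.2 h)), Complex.ofReal_zero, zero_mul]
  rw [hsum, hsum (fun j => (c j : ℂ)), groundState_siteOp_siteOp_add] at hbound
  exact hbound.trans_lt (hN₀ N (le_of_max_le_left hN))

theorem tendsto_groundState_σz (hJ : 0 < J) (i : ℕ) :
    Tendsto (fun N : ℕ => groundState N n J φ (siteOp N σz i)) atTop (𝓝 0) := by
  have h := (tendsto_groundState_opB_opA (n := n) (φ := φ) hJ i i).neg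
  rw [sub_self, G_zero, Complex.ofReal_zero, neg_zero] at h
  refine h.congr' ?_
  filter_upwards [eventually_gt_atTop i] with N hi
  rw [siteOp_σz_eq hi, opB_anticomm_opA hi hi, map_neg, neg_neg]

end FourPointFunction

end ClusterIsing

theorem mainTheorem3 (n : ℕ) (hn : 1 ≤ n) (J : ℝ) (hJ : 0 < J) (φ : ℝ) :
    -- in the thermodynamic limit `⟨B_i A_k⟩` is `G_r(n, φ)` with `r = i - k`
    (∀ i k : ℕ,
      Tendsto (fun N : ℕ =>
          ClusterIsing.expect N n J φ (ClusterIsing.opB N i * ClusterIsing.opA N k))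
        atTop (𝓝 ((ClusterIsing.G n φ ((i : ℤ) - (k : ℤ)) : ℝ) : ℂ))) ∧
    -- `G_r(n, φ)` vanishes unless `r = l (n + 2) + 1` for some integer `l`
    (∀ r : ℤ, (¬ ∃ l : ℤ, r = l * ((n : ℤ) + 2) + 1) → ClusterIsing.G n φ r = 0) ∧
    -- `⟨σ^z_i⟩ = 0` in the thermodynamic limit
    (∀ i : ℕ,
      Tendsto (fun N : ℕ =>
          ClusterIsing.expect N n J φ (ClusterIsing.siteOp N ClusterIsing.σz i))
        atTop (𝓝 0)) ∧
    -- `⟨σ^z_i σ^z_k⟩ = 0` for `i ≠ k` in the thermodynamic limit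
    (∀ i k : ℕ, i ≠ k →
      Tendsto (fun N : ℕ =>
          ClusterIsing.expect N n J φ
            (ClusterIsing.siteOp N ClusterIsing.σz i * ClusterIsing.siteOp N ClusterIsing.σz k))
        atTop (𝓝 0)) ∧
    -- a product of Pauli operators on different sites with an odd number of factors `σ^x` or an
    -- odd number of factors `σ^y` has vanishing expectation, on every ring of at least `n + 2` sites
    (∀ N : ℕ, n + 2 ≤ N → ∀ w : Fin N → Fin 4,
      (Odd (Finset.univ.filter fun l => w l = 1).card ∨
        Odd (Finset.univ.filter fun l => w l = 2).card) →
      ClusterIsing.expect N n J φ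
        (ClusterIsing.tensorOp fun l => ClusterIsing.pauli (w l)) = 0) :=
  ⟨fun i k => ClusterIsing.tendsto_groundState_opB_opA hJ i k,
    fun r hr => ClusterIsing.G_eq_zero r hr,
    fun i => ClusterIsing.tendsto_groundState_σz hJ i,
    fun _ _ hik => ClusterIsing.tendsto_groundState_σz_σz hn hJ hik,
    fun _ hN w hw => ClusterIsing.groundState_pauli_eq_zero hN w hw⟩
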